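/- Let $F$ be a finite 4-regular graph (loops and parallel edges allowed; every edge consists of two half-edges, and four half-edges are incident on each vertex), and let $E$ be a set of edges that contains exactly one edge from each connected component of $F$. An oriented Euler system $C$ of $F$ consists of one oriented closed trail for each connected component of $F$, traversing every edge of that component exactly once. Each vertex $v$ is visited twice by $C$, and the two closed trails obtained by following $C$ from one visit at $v$ to the next are the fundamental circuits of $C$ at $v$; they inherit an orientation from $C$. Let $\Gamma^o_E=\{C_\Gamma(v)\mid v\in V(F)\}$ consist of the consistently oriented fundamental circuits, one at each vertex, that contain no edge of $E$. Of the two passages of $C$ through $v$, let $v^-$ be the one at which $C_\Gamma(v)$ begins and $v^+$ the one at which it ends. Let $$IAS_{\Gamma^o_E}(C)=\begin{pmatrix} I & A & B\end{pmatrix}$$ be the integer matrix with three $V(F)\times V(F)$ blocks in which $I$ is the identity matrix; for $v\ne w$, $A_{vw}$ is $1$ if $C_\Gamma(v)$ includes $w^+$ but not $w^-$, is $-1$ if it includes $w^-$ but not $w^+$, and is $0$ otherwise, and $B_{vw}\in\{0,1,2\}$ is the number of the passages $w^-,w^+$ included in $C_\Gamma(v)$; and $A_{vv}=0$, $B_{vv}=1$.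 The $v$ columns of $I$, $A$, $B$ are denoted $\phi(v),\chi(v),\psi(v)$. The interlacement graph $\mathcal I(C)$ is the simple graph on $V(F)$ in which $v\neq w$ are adjacent if and only if they appear on a circuit of $C$ in the cyclic order $vwvw$. For a simple graph $G$, let $M[IAS(G)]$ be the matroid represented over $GF(2)$ by $(I\;\;A(G)\;\;I+A(G))$, where $A(G)$ is the adjacency matrix, with elements $\phi(v),\chi(v),\psi(v)$ corresponding to the $v$ columns of the blocks. A subtransversal is a set of these elements that contains at most one of $\phi(v),\chi(v),\psi(v)$ for each $v$. The isotropic 3-matroid $\mathcal Z_3(G)$ is the set of these elements, partitioned into the triples $\{\phi(v),\chi(v),\psi(v)\}$, together with the restriction of the rank function of $M[IAS(G)]$ to the subtransversals. A strict sheltering matroid for $\mathcal Z_3(G)$ is a matroid of rank $|V(G)|$ on the same elements, whose rank function agrees with that of $\mathcal Z_3(G)$ on all subtransversals. Let $\mathbb F$ be any field, and let $M_{\mathbb F}[IAS_{\Gamma^o_E}(C)]$ be the matroid represented by the matrix whose entries are the images in $\mathbb F$ of the entries of $IAS_{\Gamma^o_E}(C)$. Then: 1. $M_{\mathbb F}[IAS_{\Gamma^o_E}(C)]$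 is a strict sheltering matroid for $\mathcal Z_3(\mathcal I(C))$. 2. For fixed $F$, $E$ and $\mathbb F$, this matroid does not depend on $C$, in the following sense. A transition at $v$ is a partition into two pairs of the four half-edges incident on $v$. Identify $\phi(v)$ with the transition at $v$ that pairs half-edges which are consecutive on $C$, $\chi(v)$ with the other transition at $v$ that pairs each half-edge arriving at $v$ with one leaving $v$ (in the directions given by $C$), and $\psi(v)$ with the third transition at $v$. Then $M_{\mathbb F}[IAS_{\Gamma^o_E}(C)]$ becomes a matroid on the set of all transitions of $F$, and this matroid is the same for all oriented Euler systems $C$ of $F$. -/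

import Mathlib

/-! ### Matroids represented by matrices, set systems with a rank function, sheltering -/

/-- The matroid represented by a matrix: its elements are the column indices, and a set of column
indices is independent when the corresponding family of columns is linearly independent. -/
noncomputable def Matrix.colMatroid {R U K : Type*} [Field K] [Finite U] (A : Matrix R U K) :
    Matroid U :=
  (IndepMatroid.ofFinite (E := (Set.univ : Set U)) Set.finite_univ
    (fun I => LinearIndepOn K (fun u => A.col u) I)
    (linearIndepOn_empty K _)
    (fun _ _ hJ hIJ => hJ.mono hIJ)
    (by
      intro I J hI hJ hlt
      by_contra hcon
      push Not at hcon
      have hsub : ∀ e ∈ J, A.col e ∈ Submodule.span K ((fun u => A.col u) '' I) := by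
        intro e he
        by_cases heI : e ∈ I
        · exact Submodule.subset_span ⟨e, heI, rfl⟩
        · by_contra hns
          exact hcon e he heI (hI.insert hns)
      have hle : Submodule.span K ((fun u => A.col u) '' J) ≤
          Submodule.span K ((fun u => A.col u) '' I) := by
        rw [Submodule.span_le]
        rintro _ ⟨e, he, rfl⟩
        exact hsub e he
      have key : ∀ S : Set U, LinearIndepOn K (fun u => A.col u) S →
          Module.finrank K (Submodule.span K ((fun u => A.col u) '' S)) = S.ncard := by
        intro S hS
        have : Fintype S := Fintype.ofFinite S
        have h := finrank_span_eq_card (R := K) (b := fun x : S => A.col x.1) hS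
        have hr : Set.range (fun x : S => A.col x.1) = (fun u => A.col u) '' S := by
          ext y; simp
        rw [hr] at h
        rw [h, ← Nat.card_eq_fintype_card, Nat.card_coe_set_eq]
      have : FiniteDimensional K (Submodule.span K ((fun u => A.col u) '' I)) :=
        FiniteDimensional.span_of_finite K ((Set.toFinite I).image _)
      have h2 := Submodule.finrank_mono hle
      rw [key I hI, key J hJ] at h2
      omega)
    (fun I _ => Set.subset_univ I)).matroid

/-- A transversal of a family `Ω` of disjoint sets: a subset of the union of `Ω` that meets every
member of `Ω` in exactly one element. -/
def IsTransversal {U : Type*} (Ω : Set (Set U)) (T : Set U) : Prop :=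
  T ⊆ ⋃₀ Ω ∧ ∀ ω ∈ Ω, ∃! x, x ∈ T ∧ x ∈ ω

/-- A subtransversal is a subset of a transversal. -/
def IsSubtransversal {U : Type*} (Ω : Set (Set U)) (S : Set U) : Prop :=
  ∃ T, IsTransversal Ω T ∧ S ⊆ T

/-- A triple `(U, Ω, r)`: the ground set is the type `U`, `Ω` is a family of subsets of `U`, and
`r` is a function on the subtransversals of `Ω`. -/
structure TransversalRank (U : Type*) where
  Ω : Set (Set U)
  r : {S : Set U // IsSubtransversal Ω S} → ℕ∞

/-- `M` is a sheltering matroid for `Z`: it has the same ground set, and the rank function of `M`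
restricts to the rank function of `Z` on the subtransversals. -/
def TransversalRank.ShelteredBy {U : Type*} (Z : TransversalRank U) (M : Matroid U) : Prop :=
  M.E = Set.univ ∧ ∀ S, M.eRk S.1 = Z.r S

/-- `M` is a strict sheltering matroid for `Z`: moreover, the rank of `M` is `|Ω|`. -/
def TransversalRank.StrictlyShelteredBy {U : Type*} (Z : TransversalRank U) (M : Matroid U) :
    Prop :=
  Z.ShelteredBy M ∧ M.eRank = Z.Ω.encard

/-! ### The isotropic 3-matroid of a simple graph -/

/-- The three kinds of columns. -/
inductive Kind : Type
  | phi
  | chi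
  | psi

instance : Finite Kind :=
  Finite.of_injective (β := Fin 3) (fun k => match k with | .phi => 0 | .chi => 1 | .psi => 2)
    (by intro a b; cases a <;> cases b <;> simp)

/-- The ground set `W(G)` for a graph with vertex set `V`: for every vertex `v` the three elements
`φ(v) = (phi, v)`, `χ(v) = (chi, v)` and `ψ(v) = (psi, v)`. -/
abbrev GroundW (V : Type*) := Kind × V

/-- The matrix `IAS(G) = (I  A(G)  I + A(G))` over `GF(2)`. -/
noncomputable def SimpleGraph.IAS {V : Type*} (G : SimpleGraph V) :
    Matrix V (GroundW V) (ZMod 2) :=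
  open Classical in
  fun v x => match x with
    | (.phi, w) => (1 : Matrix V V (ZMod 2)) v w
    | (.chi, w) => G.adjMatrix (ZMod 2) v w
    | (.psi, w) => (1 + G.adjMatrix (ZMod 2) : Matrix V V (ZMod 2)) v w

/-- The isotropic 3-matroid `Z₃(G)`: the partition of `W(G)` into the triples
`{φ(v), χ(v), ψ(v)}`, with the restriction of the rank function of the binary matroid
`M[IAS(G)]` to the subtransversals. -/
noncomputable def SimpleGraph.isotropicThreeMatroid {V : Type*} [Finite V] (G : SimpleGraph V) :
    TransversalRank (GroundW V) where
  Ω := {ω | ∃ v : V, ω = {(.phi, v), (.chi, v), (.psi, v)}}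
  r := fun S => G.IAS.colMatroid.eRk S.1

/-! ### 4-regular graphs, oriented circuits, oriented Euler systems -/

/-- A 4-regular graph, possibly with loops and parallel edges, with vertex set `V` and set of
half-edges `H`. Every half-edge `h` is incident on the vertex `vert h`; the edges are the pairs
`{h, mate h}`. -/
structure FourRegularGraph (V H : Type*) where
  vert : H → V
  mate : H → H
  mate_mate : ∀ h, mate (mate h) = h
  mate_ne : ∀ h, mate h ≠ h
  four_regular : ∀ v, {h | vert h = v}.ncard = 4

namespace FourRegularGraph

variable {V H : Type*} (F : FourRegularGraph V H)

/-- The edge that contains the half-edge `h`. -/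
def edge (h : H) : Sym2 H := s(h, F.mate h)

/-- The simple graph of adjacencies between distinct vertices; it only serves to speak about
connected components. -/
def underlying : SimpleGraph V :=
  SimpleGraph.fromRel (fun v w => ∃ h, F.vert h = v ∧ F.vert (F.mate h) = w)

/-- The connected components of the graph. -/
abbrev Component := F.underlying.ConnectedComponent

/-- The connected component of a vertex. -/
def comp (v : V) : F.Component := F.underlying.connectedComponentMk v

/-- An oriented circuit (closed trail, up to the choice of the starting point). It is given by the
cyclic sequence of the half-edges through which it leaves the vertices: a half-edge `h` of the
sequence is followed by `mate h`, and the next half-edge of the sequence is incident on the same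
vertex as `mate h`. No half-edge is used twice. -/
def IsOrientedCircuit (c : Cycle H) : Prop :=
  c ≠ Cycle.nil ∧ c.Nodup ∧ (∀ h ∈ c, F.mate h ∉ c) ∧
    c.Chain (fun h h' => F.vert (F.mate h) = F.vert h')

/-- An oriented Euler system: for every connected component, an oriented circuit that includes
every half-edge of the component (and no others). -/
structure OrientedEulerSystem where
  circuit : F.Component → Cycle H
  isOrientedCircuit : ∀ K, F.IsOrientedCircuit (circuit K)
  euler : ∀ K h, (h ∈ circuit K ∨ F.mate h ∈ circuit K) ↔ F.comp (F.vert h) = K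

/-- `E` contains exactly one edge from each connected component, and nothing else. -/
def IsBaseEdgeSet (E : Set (Sym2 H)) : Prop :=
  E ⊆ Set.range F.edge ∧ ∀ K : F.Component, ∃! e, e ∈ E ∧ ∃ h ∈ e, F.comp (F.vert h) = K

/-- A transition: a partition of the four half-edges at a vertex into two pairs. -/
@[ext]
structure Transition where
  vertex : V
  pairs : Set (Sym2 H)
  isPartition : ∃ a b c d : H, [a, b, c, d].Nodup ∧ {h | F.vert h = vertex} = {a, b, c, d} ∧
    pairs = {s(a, b), s(c, d)}

namespace OrientedEulerSystem

variable {F} (C : F.OrientedEulerSystem)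

/-! ### Interlacement -/

/-- Distinct vertices are interlaced when they appear on a circuit of `C` in the cyclic order
`v … w … v … w …`. -/
def Interlaced (v w : V) : Prop :=
  v ≠ w ∧ ∃ K l₁ l₂ l₃ l₄, (C.circuit K).map F.vert =
    ↑((v :: l₁) ++ (w :: l₂) ++ (v :: l₃) ++ (w :: l₄))

/-- The interlacement graph. -/
def interlacementGraph : SimpleGraph V where
  Adj := C.Interlaced
  symm := ⟨by
    rintro v w ⟨hne, K, l₁, l₂, l₃, l₄, h⟩
    refine ⟨hne.symm, K, l₂, l₃, l₄, l₁, ?_⟩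
    rw [h, Cycle.coe_eq_coe]
    have := List.isRotated_append (l := v :: l₁) (l' := (w :: l₂) ++ (v :: l₃) ++ (w :: l₄))
    simpa using this⟩
  loopless := ⟨fun _ h => h.1 rfl⟩

/-! ### Transitions labelled by an Euler system -/

/-- `h` is the initial half-edge of its edge, as directed by `C`. -/
def Initial (h : H) : Prop := ∃ K, h ∈ C.circuit K

/-- The passage `a, v, b`: a circuit of `C` arrives at a vertex through the half-edge `a` and
immediately leaves it through the half-edge `b`. -/
def Passage (a b : H) : Prop := ∃ K l, C.circuit K = ↑(F.mate a :: b :: l)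

/-- The pairs of half-edges of the transition at `v` with a given label: `φ` pairs half-edges
that are consecutive on `C`, `χ` is the other transition that pairs each half-edge arriving at
`v` with one leaving `v`, and `ψ` pairs the arriving half-edges with each other and the leaving
half-edges with each other. -/
def labelPairs : Kind → V → Set (Sym2 H)
  | .phi, v => {p | ∃ a b, F.vert a = v ∧ F.vert b = v ∧ C.Passage a b ∧ p = s(a, b)}
  | .chi, v => {p | ∃ a b, F.vert a = v ∧ F.vert b = v ∧ ¬ C.Initial a ∧ C.Initial b ∧
      ¬ C.Passage a b ∧ p = s(a, b)}
  | .psi, v => {p | ∃ a b, F.vert a = v ∧ F.vert b = v ∧ a ≠ b ∧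
      (C.Initial a ↔ C.Initial b) ∧ p = s(a, b)}

/-! The three labels give the three transitions at each vertex. -/

theorem comp_eq_of_mem {K : F.Component} {h : H} (hh : h ∈ C.circuit K) :
    F.comp (F.vert h) = K := (C.euler K h).1 (Or.inl hh)

theorem initial_iff (h : H) : C.Initial h ↔ ¬ C.Initial (F.mate h) := by
  constructor
  · rintro ⟨K, hK⟩ ⟨K', hK'⟩
    have h1 := C.comp_eq_of_mem hK
    have h2 := (C.euler K' h).1 (Or.inr hK')
    obtain rfl : K = K' := h1.symm.trans h2
    exact (C.isOrientedCircuit K).2.2.1 h hK hK'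
  · intro hn
    rcases (C.euler (F.comp (F.vert h)) h).2 rfl with h1 | h1
    · exact ⟨_, h1⟩
    · exact absurd ⟨_, h1⟩ hn

theorem exists_cons {c : Cycle H} {h : H} (hh : h ∈ c) : ∃ l, c = ↑(h :: l) := by
  induction c using Quotient.inductionOn' with
  | h L =>
    have hL : h ∈ L := hh
    obtain ⟨l₁, l₂, rfl⟩ := List.append_of_mem hL
    refine ⟨l₂ ++ l₁, ?_⟩
    rw [Cycle.mk''_eq_coe, Cycle.coe_eq_coe]
    simpa using List.isRotated_append (l := l₁) (l' := h :: l₂)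

theorem exists_cons_cons {K : F.Component} {h : H} (hh : h ∈ C.circuit K) :
    ∃ b l, C.circuit K = ↑(h :: b :: l) := by
  obtain ⟨l, hl⟩ := exists_cons hh
  rcases l with _ | ⟨b, l⟩
  · exfalso
    have hsub : {x | F.vert x = F.vert h} ⊆ {h, F.mate h} := by
      intro x hx
      have hK : F.comp (F.vert x) = K := by
        rw [show F.vert x = F.vert h from hx]; exact C.comp_eq_of_mem hh
      rcases (C.euler K x).2 hK with h1 | h1 <;> rw [hl] at h1
      · left; simpa using h1
      · right
        have : F.mate x = h := by simpa using h1
        rw [Set.mem_singleton_iff, ← this, F.mate_mate]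
    have h4 := F.four_regular (F.vert h)
    have h2 := Set.ncard_le_ncard hsub (Set.toFinite _)
    have h3 := Set.ncard_insert_le h {F.mate h}
    rw [Set.ncard_singleton] at h3
    omega
  · exact ⟨b, l, hl⟩

theorem passage_initial_right {a b : H} (h : C.Passage a b) : C.Initial b := by
  obtain ⟨K, l, h⟩ := h
  exact ⟨K, by rw [h]; simp⟩

theorem passage_initial_left {a b : H} (h : C.Passage a b) : ¬ C.Initial a := by
  obtain ⟨K, l, h⟩ := h
  rw [C.initial_iff, not_not]
  exact ⟨K, by rw [h]; simp⟩

theorem passage_vert {a b : H} (h : C.Passage a b) : F.vert a = F.vert b := by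
  obtain ⟨K, l, h⟩ := h
  have := (C.isOrientedCircuit K).2.2.2
  rw [h, Cycle.chain_coe_cons] at this
  have h2 : F.vert (F.mate (F.mate a)) = F.vert b := by
    simp only [List.cons_append, List.isChain_cons_cons] at this
    exact this.1
  rwa [F.mate_mate] at h2

theorem passage_exists_right {a : H} (h : ¬ C.Initial a) : ∃ b, C.Passage a b := by
  rw [C.initial_iff, not_not] at h
  obtain ⟨K, hK⟩ := h
  obtain ⟨b, l, hl⟩ := C.exists_cons_cons hK
  exact ⟨b, K, l, hl⟩

theorem passage_exists_left {b : H} (h : C.Initial b) : ∃ a, C.Passage a b := by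
  obtain ⟨K, hK⟩ := h
  obtain ⟨x, l, hl⟩ := C.exists_cons_cons hK
  rcases List.eq_nil_or_concat (x :: l) with h0 | ⟨m, y, hm⟩
  · simp at h0
  · refine ⟨F.mate y, K, m, ?_⟩
    rw [hl, hm, F.mate_mate, Cycle.coe_eq_coe]
    simpa using List.isRotated_append (l := b :: m) (l' := [y])

theorem next_eq [DecidableEq H] {c : Cycle H} (hn : c.Nodup) {x y : H} {l : List H}
    (h : c = ↑(x :: y :: l)) (hx : x ∈ c) : c.next hn x hx = y := by
  subst h
  exact List.next_cons_cons_eq (l := l) x y (by simp)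

theorem passage_unique_right {a b b' : H} (h : C.Passage a b) (h' : C.Passage a b') : b = b' := by
  classical
  obtain ⟨K, l, h⟩ := h
  obtain ⟨K', l', h'⟩ := h'
  have m1 : F.mate a ∈ C.circuit K := by rw [h]; simp
  have m2 : F.mate a ∈ C.circuit K' := by rw [h']; simp
  obtain rfl : K = K' := (C.comp_eq_of_mem m1).symm.trans (C.comp_eq_of_mem m2)
  have hn := (C.isOrientedCircuit K).2.1
  rw [← next_eq hn h m1, ← next_eq hn h' m1]

theorem passage_unique_left {a a' b : H} (h : C.Passage a b) (h' : C.Passage a' b) : a = a' := by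
  classical
  obtain ⟨K, l, h⟩ := h
  obtain ⟨K', l', h'⟩ := h'
  have m1 : b ∈ C.circuit K := by rw [h]; simp
  have m2 : b ∈ C.circuit K' := by rw [h']; simp
  obtain rfl : K = K' := (C.comp_eq_of_mem m1).symm.trans (C.comp_eq_of_mem m2)
  have hn := (C.isOrientedCircuit K).2.1
  have q1 : F.mate a ∈ C.circuit K := by rw [h]; simp
  have q2 : F.mate a' ∈ C.circuit K := by rw [h']; simp
  have e1 := Cycle.prev_next _ hn (F.mate a) q1
  have e2 := Cycle.prev_next _ hn (F.mate a') q2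
  simp only [next_eq hn h q1] at e1
  simp only [next_eq hn h' q2] at e2
  rw [← F.mate_mate a, ← F.mate_mate a', ← e1, ← e2]

/-- The two passages of `C` through a vertex. -/
theorem local_structure (v : V) : ∃ a₁ b₁ a₂ b₂ : H, [a₁, b₁, a₂, b₂].Nodup ∧
    {h | F.vert h = v} = {a₁, b₁, a₂, b₂} ∧ ¬ C.Initial a₁ ∧ C.Initial b₁ ∧ ¬ C.Initial a₂ ∧
    C.Initial b₂ ∧ C.Passage a₁ b₁ ∧ C.Passage a₂ b₂ := by
  have hfin : {h | F.vert h = v}.Finite :=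
    Set.finite_of_ncard_ne_zero (by rw [F.four_regular v]; omega)
  set I : Set H := {h | F.vert h = v ∧ ¬ C.Initial h} with hI
  set O : Set H := {h | F.vert h = v ∧ C.Initial h} with hO
  have hIf : I.Finite := hfin.subset fun _ h => h.1
  have hOf : O.Finite := hfin.subset fun _ h => h.1
  have hu : {h | F.vert h = v} = I ∪ O := by
    ext h; by_cases hh : C.Initial h <;> simp [hI, hO, hh]
  have hdis : Disjoint I O := Set.disjoint_left.2 fun _ h h' => h.2 h'.2
  have hsum := F.four_regular v
  rw [hu, Set.ncard_union_eq hdis hIf hOf] at hsum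
  choose! f hf using fun a (ha : ¬ C.Initial a) => C.passage_exists_right ha
  have hcard : I.ncard = O.ncard := by
    refine Set.ncard_congr (fun a _ => f a) ?_ ?_ ?_
    · intro a ha
      exact ⟨(C.passage_vert (hf a ha.2)).symm.trans ha.1, C.passage_initial_right (hf a ha.2)⟩
    · intro a b ha hb hab
      have h1 := hf a ha.2
      have h2 := hf b hb.2
      rw [show f a = f b from hab] at h1
      exact C.passage_unique_left h1 h2
    · intro b hb
      obtain ⟨a, ha⟩ := C.passage_exists_left hb.2
      have ha' := C.passage_initial_left ha
      exact ⟨a, ⟨(C.passage_vert ha).trans hb.1, ha'⟩, C.passage_unique_right (hf a ha') ha⟩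
  obtain ⟨b₁, b₂, hne, hOe⟩ := Set.ncard_eq_two.1 (show O.ncard = 2 by omega)
  have m1 : b₁ ∈ O := by rw [hOe]; simp
  have m2 : b₂ ∈ O := by rw [hOe]; simp
  obtain ⟨a₁, p1⟩ := C.passage_exists_left m1.2
  obtain ⟨a₂, p2⟩ := C.passage_exists_left m2.2
  have n1 : a₁ ∈ I := ⟨(C.passage_vert p1).trans m1.1, C.passage_initial_left p1⟩
  have n2 : a₂ ∈ I := ⟨(C.passage_vert p2).trans m2.1, C.passage_initial_left p2⟩
  have hne' : a₁ ≠ a₂ := by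
    rintro rfl
    exact hne (C.passage_unique_right p1 p2)
  have hIe : {a₁, a₂} = I := by
    refine Set.eq_of_subset_of_ncard_le ?_ ?_ hIf
    · rintro x (rfl | rfl) <;> assumption
    · rw [Set.ncard_pair hne']; omega
  have hd : ∀ a ∈ I, ∀ b ∈ O, a ≠ b := fun a ha b hb hab => ha.2 (hab ▸ hb.2)
  refine ⟨a₁, b₁, a₂, b₂, ?_, ?_, n1.2, m1.2, n2.2, m2.2, p1, p2⟩
  · simp only [List.nodup_cons, List.mem_cons, not_or, List.not_mem_nil, not_false_eq_true,
      List.nodup_nil, and_true]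
    exact ⟨⟨hd _ n1 _ m1, hne', hd _ n1 _ m2⟩, ⟨(hd _ n2 _ m1).symm, hne⟩, hd _ n2 _ m2⟩
  · rw [hu, hOe, ← hIe]
    ext x
    simp only [Set.mem_union, Set.mem_insert_iff, Set.mem_singleton_iff]
    tauto

/-- The three transitions at a vertex in terms of the two passages of `C`. -/
theorem labelPairs_eq {v : V} {a₁ b₁ a₂ b₂ : H} (hnd : [a₁, b₁, a₂, b₂].Nodup)
    (hset : {h | F.vert h = v} = {a₁, b₁, a₂, b₂}) (i1 : ¬ C.Initial a₁) (j1 : C.Initial b₁)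
    (i2 : ¬ C.Initial a₂) (j2 : C.Initial b₂) (p1 : C.Passage a₁ b₁) (p2 : C.Passage a₂ b₂) :
    C.labelPairs .phi v = {s(a₁, b₁), s(a₂, b₂)} ∧
    C.labelPairs .chi v = {s(a₁, b₂), s(a₂, b₁)} ∧
    C.labelPairs .psi v = {s(a₁, a₂), s(b₁, b₂)} := by
  have hv : ∀ x, F.vert x = v ↔ x = a₁ ∨ x = b₁ ∨ x = a₂ ∨ x = b₂ := fun x => by
    simpa using Set.ext_iff.1 hset x
  have va1 := (hv a₁).2 (by simp)
  have va2 := (hv a₂).2 (by simp)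
  have vb1 := (hv b₁).2 (by simp)
  have vb2 := (hv b₂).2 (by simp)
  simp only [List.nodup_cons, List.mem_cons, not_or, List.not_mem_nil, not_false_eq_true,
      List.nodup_nil, and_true] at hnd
  obtain ⟨⟨-, haa, -⟩, ⟨-, hbb⟩, -⟩ := hnd
  have q12 : ¬ C.Passage a₁ b₂ := fun h => hbb (C.passage_unique_right p1 h)
  have q21 : ¬ C.Passage a₂ b₁ := fun h => hbb (C.passage_unique_right h p2)
  refine ⟨?_, ?_, ?_⟩ <;> ext p <;>
    simp only [labelPairs, Set.mem_ofPred_eq, Set.mem_insert_iff, Set.mem_singleton_iff]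
  · constructor
    · rintro ⟨a, b, ha, hb, hp, rfl⟩
      have h1 := C.passage_initial_left hp
      have h2 := C.passage_initial_right hp
      rcases (hv a).1 ha with rfl | rfl | rfl | rfl
      · left; rw [C.passage_unique_right hp p1]
      · exact absurd j1 h1
      · right; rw [C.passage_unique_right hp p2]
      · exact absurd j2 h1
    · rintro (rfl | rfl)
      · exact ⟨_, _, va1, vb1, p1, rfl⟩
      · exact ⟨_, _, va2, vb2, p2, rfl⟩
  · constructor
    · rintro ⟨a, b, ha, hb, h1, h2, hp, rfl⟩
      rcases (hv a).1 ha with rfl | rfl | rfl | rfl <;>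
        rcases (hv b).1 hb with rfl | rfl | rfl | rfl <;> simp_all
    · rintro (rfl | rfl)
      · exact ⟨_, _, va1, vb2, i1, j2, q12, rfl⟩
      · exact ⟨_, _, va2, vb1, i2, j1, q21, rfl⟩
  · constructor
    · rintro ⟨a, b, ha, hb, hab, h1, rfl⟩
      rcases (hv a).1 ha with rfl | rfl | rfl | rfl <;>
        rcases (hv b).1 hb with rfl | rfl | rfl | rfl <;> simp_all [Sym2.eq_swap]
    · rintro (rfl | rfl)
      · exact ⟨_, _, va1, va2, haa, by tauto, rfl⟩
      · exact ⟨_, _, vb1, vb2, hbb, by tauto, rfl⟩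

/-- The transition `φ_C(v)`, `χ_C(v)` or `ψ_C(v)`. -/
def transition (x : GroundW V) : F.Transition where
  vertex := x.2
  pairs := C.labelPairs x.1 x.2
  isPartition := by
    obtain ⟨k, v⟩ := x
    obtain ⟨a₁, b₁, a₂, b₂, hnd, hset, i1, j1, i2, j2, p1, p2⟩ := C.local_structure v
    obtain ⟨e1, e2, e3⟩ := C.labelPairs_eq hnd hset i1 j1 i2 j2 p1 p2
    cases k
    · exact ⟨a₁, b₁, a₂, b₂, hnd, hset, e1⟩
    · refine ⟨a₁, b₂, a₂, b₁, ?_, ?_, e2⟩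
      · simp at hnd ⊢; tauto
      · rw [hset]; ext x; simp; tauto
    · refine ⟨a₁, a₂, b₁, b₂, ?_, ?_, e3⟩
      · simp at hnd ⊢; tauto
      · rw [hset]; ext x; simp; tauto

theorem transition_bijective : Function.Bijective C.transition := by
  constructor
  · rintro ⟨k, v⟩ ⟨k', v'⟩ h
    obtain rfl : v = v' := congrArg Transition.vertex h
    have hp : C.labelPairs k v = C.labelPairs k' v := congrArg Transition.pairs h
    obtain ⟨a₁, b₁, a₂, b₂, hnd, hset, i1, j1, i2, j2, p1, p2⟩ := C.local_structure v
    obtain ⟨e1, e2, e3⟩ := C.labelPairs_eq hnd hset i1 j1 i2 j2 p1 p2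
    simp only [List.nodup_cons, List.mem_cons, not_or, List.not_mem_nil, not_false_eq_true,
      List.nodup_nil, and_true] at hnd
    have t1 := Set.ext_iff.1 hp s(a₁, b₁)
    have t2 := Set.ext_iff.1 hp s(a₁, b₂)
    cases k <;> cases k' <;> first | rfl | skip
    all_goals
      exfalso
      simp only [e1, e2, e3, Set.mem_insert_iff, Set.mem_singleton_iff, Sym2.eq_iff] at t1 t2
      clear hp h hset e1 e2 e3
      grind
  · rintro ⟨v, P, a, b, c, d, hn, hs, rfl⟩
    obtain ⟨a₁, b₁, a₂, b₂, hnd, hset, i1, j1, i2, j2, p1, p2⟩ := C.local_structure v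
    obtain ⟨e1, e2, e3⟩ := C.labelPairs_eq hnd hset i1 j1 i2 j2 p1 p2
    suffices h : ∃ k, C.labelPairs k v = {s(a, b), s(c, d)} by
      obtain ⟨k, hk⟩ := h
      exact ⟨(k, v), Transition.ext rfl hk⟩
    have hv : ∀ x, (x = a ∨ x = b ∨ x = c ∨ x = d) ↔ (x = a₁ ∨ x = b₁ ∨ x = a₂ ∨ x = b₂) :=
      fun x => by simpa using Set.ext_iff.1 (hs.symm.trans hset) x
    have hw : ∃ x y z, ({s(a, b), s(c, d)} : Set (Sym2 H)) = {s(a₁, x), s(y, z)} ∧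
        [a₁, x, y, z].Nodup ∧
        ∀ t, (t = a₁ ∨ t = x ∨ t = y ∨ t = z) ↔ (t = a₁ ∨ t = b₁ ∨ t = a₂ ∨ t = b₂) := by
      simp only [List.nodup_cons, List.mem_cons, not_or, List.not_mem_nil, not_false_eq_true,
        List.nodup_nil, and_true] at hn ⊢
      rcases (hv a₁).2 (Or.inl rfl) with h | h | h | h
      · exact ⟨b, c, d, by rw [h], by grind, fun t => by rw [← hv t]; grind⟩
      · exact ⟨a, c, d, by rw [h, Sym2.eq_swap], by grind, fun t => by rw [← hv t]; grind⟩
      · exact ⟨d, a, b, by rw [h, Set.pair_comm], by grind, fun t => by rw [← hv t]; grind⟩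
      · exact ⟨c, a, b, by rw [h, Set.pair_comm, Sym2.eq_swap (a := c)], by grind,
          fun t => by rw [← hv t]; grind⟩
    obtain ⟨x, y, z, he, hxyz, ht⟩ := hw
    rw [he]
    simp only [List.nodup_cons, List.mem_cons, not_or, List.not_mem_nil, not_false_eq_true,
      List.nodup_nil, and_true] at hxyz hnd
    have hyz : ∀ p q : H, (y = p ∧ z = q) ∨ (y = q ∧ z = p) → s(y, z) = s(p, q) := by
      rintro p q (⟨rfl, rfl⟩ | ⟨rfl, rfl⟩)
      · rfl
      · exact Sym2.eq_swap
    have hx := (ht x).1 (by simp)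
    have hy := (ht y).1 (by simp)
    have hz := (ht z).1 (by simp)
    clear hv hs he hn e1 e2 e3
    rcases hx with h | h | h | h
    · exact absurd h.symm hxyz.1.1
    · exact ⟨.phi, by rw [(C.labelPairs_eq (by simpa using hnd) hset i1 j1 i2 j2 p1 p2).1, h,
        hyz a₂ b₂ (by grind)]⟩
    · exact ⟨.psi, by rw [(C.labelPairs_eq (by simpa using hnd) hset i1 j1 i2 j2 p1 p2).2.2, h,
        hyz b₁ b₂ (by grind)]⟩
    · exact ⟨.chi, by rw [(C.labelPairs_eq (by simpa using hnd) hset i1 j1 i2 j2 p1 p2).2.1, h,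
        hyz a₂ b₁ (by grind)]⟩

/-- The bijection between `W(I(C))` and the set of transitions. -/
noncomputable def transitionEquiv : GroundW V ≃ F.Transition :=
  Equiv.ofBijective C.transition C.transition_bijective

/-! ### Fundamental circuits and the integer matrix -/

/-- `γ` is one of the two fundamental circuits of `C` at `v`, oriented consistently with `C` and
listed (by the half-edges through which it leaves the vertices) from its starting point `v`: the
circuit of `C` through `v` consists of `γ`, which starts at the first of the two visits to `v`
and stops at the second one, and of the remaining part, which also leads from `v` to `v`. -/
def IsFundamentalCircuit (v : V) (γ : List H) : Prop :=
  ∃ (h h' : H) (α β : List H), γ = h :: α ∧ F.vert h = v ∧ F.vert h' = v ∧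
    C.circuit (F.comp v) = ↑((h :: α) ++ (h' :: β))

/-- A set of consistently oriented fundamental circuits of `C`, one at each vertex. -/
structure FundamentalCircuits where
  circ : V → List H
  isFundamental : ∀ v, C.IsFundamentalCircuit v (circ v)

namespace FundamentalCircuits

variable {C} (Γ : C.FundamentalCircuits)

/-- The fundamental circuits exclude every element of the set of edges `E`. -/
def IsBased (E : Set (Sym2 H)) : Prop := ∀ v, ∀ h ∈ Γ.circ v, F.edge h ∉ E

/-- The passage `w⁻` of `C` through `w` leaves `w` through `h`: it is the passage with which the
fundamental circuit at `w` begins. -/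
def MinusExit (w : V) (h : H) : Prop := ∃ α, Γ.circ w = h :: α

/-- The passage `w⁺` of `C` through `w` leaves `w` through `h`: it is the passage of `C` that
comes immediately after the fundamental circuit at `w`. -/
def PlusExit (w : V) (h : H) : Prop :=
  ∃ β, C.circuit (F.comp w) = ↑(Γ.circ w ++ h :: β)

/-- The fundamental circuit at `v` includes the passage `w⁻` (meant for `v ≠ w`). -/
def IncludesMinus (v w : V) : Prop := ∃ h ∈ Γ.circ v, Γ.MinusExit w h

/-- The fundamental circuit at `v` includes the passage `w⁺` (meant for `v ≠ w`). -/
def IncludesPlus (v w : V) : Prop := ∃ h ∈ Γ.circ v, Γ.PlusExit w h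

open Classical in
/-- The block `A` of the integer matrix. -/
noncomputable def matA : Matrix V V ℤ := fun v w =>
  if v ≠ w ∧ Γ.IncludesPlus v w ∧ ¬ Γ.IncludesMinus v w then 1
  else if v ≠ w ∧ Γ.IncludesMinus v w ∧ ¬ Γ.IncludesPlus v w then -1
  else 0

open Classical in
/-- The block `B` of the integer matrix. -/
noncomputable def matB : Matrix V V ℤ := fun v w =>
  if v ≠ w ∧ ¬ Γ.IncludesPlus v w ∧ ¬ Γ.IncludesMinus v w then 0
  else if v ≠ w ∧ Γ.IncludesPlus v w ∧ Γ.IncludesMinus v w then 2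
  else 1

/-- The integer matrix `IAS_Γ(C) = (I  A  B)`; the columns of `I`, `A`, `B` correspond to the
elements `φ`, `χ`, `ψ` of `W(I(C))`, respectively. -/
noncomputable def IAS : Matrix V (GroundW V) ℤ :=
  open Classical in
  fun v x => match x with
    | (.phi, w) => (1 : Matrix V V ℤ) v w
    | (.chi, w) => Γ.matA v w
    | (.psi, w) => Γ.matB v w

/-- The matroid on `W(I(C))` represented by the images in `K` of the entries of `IAS_Γ(C)`. -/
noncomputable def matroid [Finite V] (K : Type*) [Field K] : Matroid (GroundW V) :=
  (Γ.IAS.map (Int.cast : ℤ → K)).colMatroid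

/-- The same matroid with its elements regarded as transitions of the 4-regular graph, through
the labels `φ_C`, `χ_C`, `ψ_C` of the transitions. -/
noncomputable def transitionMatroid [Finite V] (K : Type*) [Field K] : Matroid F.Transition :=
  (Γ.matroid K).mapEquiv C.transitionEquiv

end FundamentalCircuits
end OrientedEulerSystem
end FourRegularGraph

namespace FourRegularGraph

variable {V H : Type*} (F : FourRegularGraph V H)

/-! The matroid has a description that does not mention `C`. Let `flowSpace` be the space of
circulations over the field that vanish on `E`. A transition splits the four half-edges at its
vertex into two pairs, and by conservation the flow from one pair to the other is, up to sign, a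
well-defined functional on this space. Fundamental circuits avoiding `E` are such circulations, and
the matrix lists, up to signs of columns, the values of the transition functionals on them
(`exists_IAS_eq_flow`). They span the space (`exists_eq_sum_flow`): subtracting suitable multiples
leaves a circulation that is constant along each Euler circuit, hence zero because each circuit
meets `E`. So the columns represent the matroid of the transition functionals, which depends only on
`F`, `E` and the field (`transitionMatroid_indep_iff`).

For sheltering, take at most one transition per vertex. A linear relation among their functionals
amounts, after subtracting a vertex potential, to a labeling of half-edges subject only to equality
constraints (`linearIndepOn_functional_iff`). Whether a nontrivial labeling exists does not depend
on the set of labels, so independence of subtransversals is the same over all fields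
(`linearIndepOn_functional_of_field`). Over GF(2) the matrix is that of the interlacement graph
(`IAS_map_zmod_two`), and the identity block gives the rank. -/

theorem finite_halfEdges {V H : Type*} (F : FourRegularGraph V H) [Finite V] : Finite H := by
  have h : (Set.univ : Set H) = ⋃ v, {h | F.vert h = v} := by ext; simp
  rw [← Set.finite_univ_iff, h]
  exact Set.finite_iUnion fun v =>
    Set.finite_of_ncard_ne_zero (by rw [F.four_regular v]; omega)

theorem edge_mate {V H : Type*} (F : FourRegularGraph V H) (h : H) : F.edge (F.mate h) = F.edge h := by
  rw [edge, edge, F.mate_mate, Sym2.eq_swap]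

/-! ### Flows and the functionals given by transitions -/

section Flow

variable [Fintype H] (E : Set (Sym2 H)) (K : Type*) [Field K]

open Classical in
/-- The total outflow from a vertex. -/
noncomputable def outflow (v : V) : (H → K) →ₗ[K] K :=
  ∑ h with F.vert h = v, LinearMap.proj h

theorem outflow_apply [DecidableEq V] (v : V) (z : H → K) :
    F.outflow K v z = ∑ h with F.vert h = v, z h := by
  simp only [outflow, LinearMap.sum_apply, LinearMap.proj_apply]
  congr!

/-- The circulations with values in `K` that vanish on the edges in `E`. A circulation assigns to
every half-edge `h` the amount that flows out of `F.vert h` through `h`. -/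
def flowSpace : Submodule K (H → K) where
  carrier := {z | (∀ h, z (F.mate h) = -z h) ∧ (∀ v, F.outflow K v z = 0) ∧
    ∀ h, F.edge h ∈ E → z h = 0}
  zero_mem' := by simp
  add_mem' := by
    rintro y z ⟨a1, a2, a3⟩ ⟨b1, b2, b3⟩
    refine ⟨fun h => ?_, fun v => ?_, fun h hh => ?_⟩
    · simp only [Pi.add_apply, a1, b1]; ring
    · rw [map_add, a2, b2, add_zero]
    · simp [a3 h hh, b3 h hh]
  smul_mem' := by
    rintro c z ⟨a1, a2, a3⟩
    refine ⟨fun h => ?_, fun v => ?_, fun h hh => ?_⟩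
    · simp only [Pi.smul_apply, a1, smul_neg]
    · rw [map_smul, a2, smul_zero]
    · simp [a3 h hh]

variable {F E K}

theorem sum_vertex_eq [DecidableEq V] {v : V} {a b c d : H} (hnd : [a, b, c, d].Nodup)
    (hset : {h | F.vert h = v} = {a, b, c, d}) (f : H → K) :
    ∑ h with F.vert h = v, f h = f a + f b + f c + f d := by
  classical
  have : (Finset.univ.filter fun h => F.vert h = v) = {a, b, c, d} := by
    ext x
    simpa using Set.ext_iff.1 hset x
  simp only [List.nodup_cons, List.mem_cons, not_or, List.not_mem_nil, not_false_eq_true,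
      List.nodup_nil, and_true] at hnd
  rw [this, Finset.sum_insert (by simp; tauto), Finset.sum_insert (by simp; tauto),
    Finset.sum_insert (by simp; tauto), Finset.sum_singleton]
  ring

theorem flow_conservation {v : V} {a b c d : H} (hnd : [a, b, c, d].Nodup)
    (hset : {h | F.vert h = v} = {a, b, c, d}) {z : H → K} (hz : z ∈ F.flowSpace E K) :
    z a + z b + z c + z d = 0 := by
  classical
  rw [← sum_vertex_eq hnd hset z, ← F.outflow_apply K, hz.2.1]

namespace Transition

variable (t : F.Transition)

/-- The flow through a transition, from one of its two pairs of half-edges to the other. -/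
noncomputable def flow (t : F.Transition) : (H → K) →ₗ[K] K :=
  LinearMap.proj (R := K) (φ := fun _ : H => K) t.isPartition.choose +
    LinearMap.proj (R := K) (φ := fun _ : H => K) t.isPartition.choose_spec.choose

omit [Fintype H] in
theorem exists_flow_eq : ∃ a b c d : H, [a, b, c, d].Nodup ∧
    {h | F.vert h = t.vertex} = {a, b, c, d} ∧ t.pairs = {s(a, b), s(c, d)} ∧
    ∀ z : H → K, t.flow z = z a + z b := by
  obtain ⟨c, d, h⟩ := t.isPartition.choose_spec.choose_spec
  exact ⟨_, _, c, d, h.1, h.2.1, h.2.2, fun z => rfl⟩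

/-- By conservation the two pairs carry opposite flows, so the arbitrary choice of a pair in `flow`
costs only a sign, which does not affect independence. -/
theorem exists_flow_eq_mul {a b : H} (h : s(a, b) ∈ t.pairs) :
    ∃ ε : Kˣ, ∀ z ∈ F.flowSpace E K, z a + z b = ε * t.flow z := by
  obtain ⟨p, q, r, s, hnd, hset, hp, hf⟩ := t.exists_flow_eq (K := K)
  rw [hp] at h
  simp only [Set.mem_insert_iff, Set.mem_singleton_iff, Sym2.eq_iff] at h
  rcases h with (⟨rfl, rfl⟩ | ⟨rfl, rfl⟩) | h
  · exact ⟨1, fun z hz => by rw [hf]; simp⟩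
  · exact ⟨1, fun z hz => by rw [hf]; simp [add_comm]⟩
  · refine ⟨-1, fun z hz => ?_⟩
    have h1 := flow_conservation hnd hset hz
    rw [hf]
    rcases h with ⟨rfl, rfl⟩ | ⟨rfl, rfl⟩ <;> simp <;> linear_combination h1

variable (E K) in
/-- The flow through a transition as a functional on the space of circulations. -/
noncomputable def functional : Module.Dual K (F.flowSpace E K) :=
  t.flow.comp (F.flowSpace E K).subtype

theorem functional_apply (z : F.flowSpace E K) : t.functional E K z = t.flow (z : H → K) := rfl

end Transition

/-! ### Independence of functionals is independent of the field -/

/-- By duality `g` is a combination of the functionals that cut out the circulations: edge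
antisymmetry, outflows, and evaluations on `E`. The potential `p` records the coefficients of the
outflows; what remains is symmetric on every edge outside `E`. -/
theorem exists_potential {g : (H → K) →ₗ[K] K} (hg : ∀ z ∈ F.flowSpace E K, g z = 0)
    [DecidableEq H] :
    ∃ p : V → K, ∀ h, F.edge h ∉ E → g (Pi.single (F.mate h) 1) - p (F.vert (F.mate h)) =
      g (Pi.single h 1) - p (F.vert h) := by
  classical
  have : Finite V := by
    refine Finite.of_surjective F.vert fun v => ?_
    have : {h | F.vert h = v}.Nonempty :=
      Set.nonempty_of_ncard_ne_zero (by rw [F.four_regular v]; omega)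
    exact this
  let L : H ⊕ V ⊕ {h // F.edge h ∈ E} → ((H → K) →ₗ[K] K) :=
    Sum.elim (fun h => LinearMap.proj (R := K) (φ := fun _ : H => K) (F.mate h) + LinearMap.proj h)
      (Sum.elim (F.outflow K) (fun h => LinearMap.proj h.1))
  have hspan : g ∈ Submodule.span K (Set.range L) := by
    refine mem_span_of_iInf_ker_le_ker fun z hz => hg z ⟨fun h => ?_, fun v => ?_, fun h hh => ?_⟩
    · have := (Submodule.mem_iInf _).1 hz (.inl h)
      simpa [L, add_eq_zero_iff_eq_neg] using this
    · exact (Submodule.mem_iInf _).1 hz (.inr (.inl v))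
    · exact (Submodule.mem_iInf _).1 hz (.inr (.inr ⟨h, hh⟩))
  clear hg
  induction hspan using Submodule.span_induction with
  | mem g hg =>
    obtain ⟨x | v | x, rfl⟩ := hg
    · refine ⟨0, fun h _ => ?_⟩
      have e1 : F.mate x = F.mate h ↔ x = h :=
        ⟨fun e => by rw [← F.mate_mate x, e, F.mate_mate], fun e => by rw [e]⟩
      have e2 : x = F.mate h ↔ F.mate x = h :=
        ⟨fun e => by rw [e, F.mate_mate], fun e => by rw [← e, F.mate_mate]⟩
      simp only [L, Sum.elim_inl, LinearMap.add_apply, LinearMap.proj_apply, Pi.single_apply,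
        Pi.zero_apply, sub_zero, e1, e2, add_comm]
    · refine ⟨fun w => if w = v then 1 else 0, fun h _ => ?_⟩
      have key : ∀ h, F.outflow K v (Pi.single h 1) = if F.vert h = v then 1 else 0 := by
        intro h
        rw [outflow_apply]
        simp [Pi.single_apply]
      simp only [L, Sum.elim_inr, Sum.elim_inl, key, sub_self]
    · refine ⟨0, fun h hh => ?_⟩
      have e1 : x.1 ≠ h := fun e => hh (e ▸ x.2)
      have e2 : x.1 ≠ F.mate h := fun e => hh (by rw [← F.edge_mate, ← e]; exact x.2)
      simp [L, e1, e2]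
  | zero => exact ⟨0, by simp⟩
  | add f g _ _ hf hg =>
    obtain ⟨p, hp⟩ := hf
    obtain ⟨q, hq⟩ := hg
    refine ⟨p + q, fun h hh => ?_⟩
    simp only [LinearMap.add_apply, Pi.add_apply]
    linear_combination hp h hh + hq h hh
  | smul c f _ hf =>
    obtain ⟨p, hp⟩ := hf
    refine ⟨c • p, fun h hh => ?_⟩
    simp only [LinearMap.smul_apply, Pi.smul_apply, smul_eq_mul]
    linear_combination c * hp h hh

/-- Labelings of the half-edges with values in `X` that are constant along the edges outside `E`,
on the pairs of half-edges of the transitions in `T`, and at the vertices without a transition in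
`T`. -/
def IsLabeling (E : Set (Sym2 H)) (T : Set F.Transition) {X : Type*} (μ : H → X) : Prop :=
  (∀ h, F.edge h ∉ E → μ (F.mate h) = μ h) ∧
  (∀ t ∈ T, ∀ a b, s(a, b) ∈ t.pairs → μ a = μ b) ∧
  ∀ v, (∀ t ∈ T, t.vertex ≠ v) → ∀ a b, F.vert a = v → F.vert b = v → μ a = μ b

/-- The two halves of each edge cancel: outside `E` the labels agree and the flows are opposite, and
on `E` the flow vanishes. -/
theorem sum_mul_flow_eq_zero {μ : H → K} (hμ : ∀ h, F.edge h ∉ E → μ (F.mate h) = μ h)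
    {z : H → K} (hz : z ∈ F.flowSpace E K) : ∑ h, μ h * z h = 0 := by
  refine Finset.sum_involution (fun h _ => F.mate h) (fun h _ => ?_) (fun h _ _ => F.mate_ne h)
    (fun _ _ => Finset.mem_univ _) (fun h _ => F.mate_mate h)
  by_cases hh : F.edge h ∈ E
  · rw [hz.1, hz.2.2 h hh]; simp
  · rw [hz.1, hμ h hh]; ring

/-- Labelings and relations correspond: the jump of a labeling between the two pairs of `t` is the
coefficient of `t`. A labeling yields a relation by summing label times flow over all half-edges,
vertex by vertex; a relation yields a labeling through `exists_potential`. -/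
theorem linearIndepOn_functional_iff [Finite V] {T : Set F.Transition}
    (hT : Set.InjOn Transition.vertex T) :
    LinearIndepOn K (fun t => t.functional E K) T ↔
      ∀ μ : H → K, IsLabeling E T μ → ∀ t ∈ T, ∀ a b, F.vert a = t.vertex → F.vert b = t.vertex →
        μ a = μ b := by
  classical
  have := Fintype.ofFinite V
  obtain ⟨T, rfl⟩ := (Set.Finite.of_finite_image (Set.toFinite _) hT).exists_finset_coe
  choose p q r s hnd hset hpairs hflow using
    fun t : F.Transition => t.exists_flow_eq (K := K)
  have hv : ∀ t x, F.vert x = t.vertex ↔ x = p t ∨ x = q t ∨ x = r t ∨ x = s t :=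
    fun t x => by simpa using Set.ext_iff.1 (hset t) x
  rw [linearIndepOn_finset_iff]
  constructor
  · rintro hind μ ⟨h1, h2, h3⟩ t ht
    have e1 : ∀ t ∈ T, μ (q t) = μ (p t) := fun t ht =>
      (h2 t ht _ _ (by rw [hpairs]; simp)).symm
    have e2 : ∀ t ∈ T, μ (s t) = μ (r t) := fun t ht =>
      (h2 t ht _ _ (by rw [hpairs]; simp)).symm
    -- At the vertex of `t`, conservation turns the local sum into the jump times the flow through
    -- `t`; at a vertex without a transition the label is constant and the local sum is zero.
    have key : ∑ t ∈ T, (μ (p t) - μ (r t)) • t.functional E K = 0 := by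
      ext z
      have hz := sum_mul_flow_eq_zero h1 z.2
      rw [← Finset.sum_fiberwise _ F.vert, ← Finset.sum_subset (T.image _).subset_univ,
        Finset.sum_image hT] at hz
      · simp only [LinearMap.sum_apply, LinearMap.smul_apply, LinearMap.zero_apply]
        refine Eq.trans (Finset.sum_congr rfl fun t ht => ?_) hz
        rw [Transition.functional_apply, hflow, sum_vertex_eq (hnd t) (hset t), e1 t ht, e2 t ht,
          smul_eq_mul]
        linear_combination (-μ (r t)) * flow_conservation (hnd t) (hset t) z.2
      · intro v _ hv
        have hc := h3 v fun t ht e => hv (Finset.mem_image.2 ⟨t, ht, e⟩)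
        have ho := z.2.2.1 v
        rw [outflow_apply] at ho
        obtain ⟨a, ha⟩ : {h | F.vert h = v}.Nonempty :=
          Set.nonempty_of_ncard_ne_zero (by rw [F.four_regular v]; omega)
        rw [Finset.sum_congr rfl fun h hh => by rw [hc h a (Finset.mem_filter.1 hh).2 ha],
          ← Finset.mul_sum, ho, mul_zero]
    have hz := hind _ key t ht
    have f1 := e1 t ht
    have f2 := e2 t ht
    rw [sub_eq_zero] at hz
    suffices ∀ a, F.vert a = t.vertex → μ a = μ (p t) by
      intro a b ha hb
      rw [this a ha, this b hb]
    intro a ha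
    rcases (hv t a).1 ha with rfl | rfl | rfl | rfl
    · rfl
    · exact f1
    · exact hz.symm
    · exact f2.trans hz.symm
  · intro hlab c hc t ht
    have hg : ∀ z ∈ F.flowSpace E K, (∑ t ∈ T, c t • t.flow) z = 0 := by
      intro z hz
      have := LinearMap.congr_fun hc ⟨z, hz⟩
      simpa [Transition.functional_apply] using this
    obtain ⟨π, hπ⟩ := exists_potential hg
    set g : (H → K) →ₗ[K] K := ∑ t ∈ T, c t • t.flow with hgdef
    -- Only one transition of `T` sits at a given vertex, so no other term reaches these half-edges.
    have gval : ∀ t ∈ T, ∀ h, F.vert h = t.vertex →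
        g (Pi.single h 1) = if h = p t ∨ h = q t then c t else 0 := by
      intro t ht h hh
      rw [hgdef, LinearMap.sum_apply, Finset.sum_eq_single t]
      · have := hnd t
        simp only [List.nodup_cons, List.mem_cons, not_or] at this
        rw [LinearMap.smul_apply, hflow, Pi.single_apply, Pi.single_apply]
        by_cases a1 : h = p t
        · subst a1; simp [this.1.1, Ne.symm this.1.1]
        · by_cases a2 : h = q t
          · subst a2; simp [this.1.1]
          · simp [a1, a2, Ne.symm a1, Ne.symm a2]
      · intro u hu hut
        have hx : ∀ x, F.vert x = u.vertex → x ≠ h := by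
          rintro x hx rfl
          exact hut (hT hu ht (hx.symm.trans hh))
        rw [LinearMap.smul_apply, hflow, Pi.single_eq_of_ne (hx _ ((hv u _).2 (by simp))),
          Pi.single_eq_of_ne (hx _ ((hv u _).2 (by simp)))]
        simp
      · exact fun h => absurd ht h
    have gzero : ∀ h, (∀ t ∈ T, t.vertex ≠ F.vert h) → g (Pi.single h 1) = 0 := by
      intro h hh
      rw [hgdef, LinearMap.sum_apply]
      refine Finset.sum_eq_zero fun u hu => ?_
      have hx : ∀ x, F.vert x = u.vertex → x ≠ h := by
        rintro x hx rfl
        exact hh u hu hx.symm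
      rw [LinearMap.smul_apply, hflow, Pi.single_eq_of_ne (hx _ ((hv u _).2 (by simp))),
        Pi.single_eq_of_ne (hx _ ((hv u _).2 (by simp)))]
      simp
    -- The potential is the same at `p t` and `r t`, which lie at one vertex, so the jump of this
    -- labeling there is exactly `c t`.
    have hl := hlab (fun h => g (Pi.single h 1) - π (F.vert h)) ⟨hπ, ?_, ?_⟩ t ht (p t) (r t)
      ((hv t _).2 (by simp)) ((hv t _).2 (by simp))
    · have vp := (hv t (p t)).2 (by simp)
      have vr := (hv t (r t)).2 (by simp)
      simp only [gval t ht _ vp, gval t ht _ vr, vp, vr] at hl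
      have := hnd t
      simp only [List.nodup_cons, List.mem_cons, not_or] at this
      simpa [Ne.symm this.1.2.1, Ne.symm this.2.1.1] using hl
    · intro t ht a b hab
      have := hnd t
      simp only [List.nodup_cons, List.mem_cons, not_or] at this
      have va : F.vert a = t.vertex := (hv t a).2 (by
        rw [hpairs] at hab
        simp only [Set.mem_insert_iff, Set.mem_singleton_iff, Sym2.eq_iff] at hab
        tauto)
      have vb : F.vert b = t.vertex := (hv t b).2 (by
        rw [hpairs] at hab
        simp only [Set.mem_insert_iff, Set.mem_singleton_iff, Sym2.eq_iff] at hab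
        tauto)
      simp only [gval t ht _ va, gval t ht _ vb, va, vb]
      rw [hpairs] at hab
      simp only [Set.mem_insert_iff, Set.mem_singleton_iff, Sym2.eq_iff] at hab
      congr 1
      refine if_congr ?_ rfl rfl
      clear hc hg hgdef gval gzero hlab hv hset hpairs hflow hπ
      grind
    · intro v hv' a b ha hb
      rw [← ha] at hv'
      have hv2 : ∀ t ∈ T, t.vertex ≠ F.vert b := fun t ht => by rw [hb, ← ha]; exact hv' t ht
      simp only [gzero a hv', gzero b hv2, ha, hb]

/-- Labeling conditions are equalities only, so they survive composition with any map of labels. The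
indicator of one label value carries a nonconstant labeling over `L` to one over `K`. -/
theorem linearIndepOn_functional_of_field [Finite V] (L : Type*) [Field L] {T : Set F.Transition}
    (hT : Set.InjOn Transition.vertex T) (h : LinearIndepOn K (fun t => t.functional E K) T) :
    LinearIndepOn L (fun t => t.functional E L) T := by
  classical
  rw [linearIndepOn_functional_iff hT] at h ⊢
  rintro μ ⟨h1, h2, h3⟩ t ht a b ha hb
  by_contra hab
  have := h (fun x => if μ x = μ a then 1 else 0) ⟨fun x hx => by simp only [h1 x hx],
    fun u hu x y hxy => by simp only [h2 u hu x y hxy],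
    fun v hv x y hx hy => by simp only [h3 v hv x y hx hy]⟩ t ht a b ha hb
  simp [Ne.symm hab] at this

end Flow

end FourRegularGraph

theorem Matrix.colMatroid_indep_iff {R U K : Type*} [Field K] [Finite U] (A : Matrix R U K)
    (I : Set U) : A.colMatroid.Indep I ↔ LinearIndepOn K (fun u => A.col u) I := Iff.rfl

namespace FourRegularGraph
namespace OrientedEulerSystem

variable {V H : Type*} {F : FourRegularGraph V H} (C : F.OrientedEulerSystem)

/-! ### Passages -/

theorem passage_of_infix {L : F.Component} {l₁ l₂ : List H} {x b : H}
    (h : C.circuit L = ↑(l₁ ++ x :: b :: l₂)) : C.Passage (F.mate x) b := by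
  refine ⟨L, l₂ ++ l₁, ?_⟩
  rw [h, F.mate_mate, Cycle.coe_eq_coe]
  simpa using List.isRotated_append (l := l₁) (l' := x :: b :: l₂)

theorem circuit_rotate {L : F.Component} {l₁ l₂ : List H} (h : C.circuit L = ↑(l₁ ++ l₂)) :
    C.circuit L = ↑(l₂ ++ l₁) := by
  rw [h, Cycle.coe_eq_coe]
  exact List.isRotated_append

theorem passage_wrap {L : F.Component} {l : List H} {b y : H}
    (h : C.circuit L = ↑(b :: l ++ [y])) : C.Passage (F.mate y) b := by
  have := C.circuit_rotate h
  exact C.passage_of_infix (l₁ := []) this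

/-- The circuit is cyclic, so the entry preceding `h` is the last one of the second stretch. -/
theorem mate_mem_of_passage_left {L : F.Component} {α β : List H} {h h' a : H}
    (hc : C.circuit L = ↑(h :: α ++ h' :: β)) (hp : C.Passage a h) : F.mate a ∈ h' :: β := by
  rcases List.eq_nil_or_concat (h' :: β) with h0 | ⟨m, y, hm⟩
  · simp at h0
  · rw [hm, List.concat_eq_append, ← List.append_assoc, List.cons_append] at hc
    rw [C.passage_unique_left hp (C.passage_wrap hc), F.mate_mate, hm]
    simp

theorem mate_mem_of_passage_mem {L : F.Component} {α γ : List H} {h a b : H}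
    (hc : C.circuit L = ↑(h :: α ++ γ)) (hp : C.Passage a b) (hb : b ∈ α) :
    F.mate a ∈ h :: α := by
  obtain ⟨l₁, l₂, rfl⟩ := List.append_of_mem hb
  rcases List.eq_nil_or_concat (h :: l₁) with h0 | ⟨m, y, hm⟩
  · simp at h0
  · have e : h :: (l₁ ++ b :: l₂) = m ++ y :: b :: l₂ := by
      rw [← List.cons_append, hm]; simp
    rw [e] at hc ⊢
    rw [List.append_assoc] at hc
    rw [C.passage_unique_left hp (C.passage_of_infix hc), F.mate_mate]
    simp

theorem mate_mem_circuit {L : F.Component} {a b : H} (hp : C.Passage a b) :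
    F.mate a ∈ C.circuit L ↔ b ∈ C.circuit L := by
  obtain ⟨L', l, h⟩ := hp
  have m1 : F.mate a ∈ C.circuit L' := by rw [h]; simp
  have m2 : b ∈ C.circuit L' := by rw [h]; simp
  constructor <;> intro hm
  · rwa [(C.comp_eq_of_mem hm).symm.trans (C.comp_eq_of_mem m1)]
  · rwa [(C.comp_eq_of_mem hm).symm.trans (C.comp_eq_of_mem m2)]

/-- The circuit passes from one stretch to the other only where it leaves through `h` or `h'`; every
other passage stays within a stretch. -/
theorem mate_mem_iff_of_passage {L : F.Component} {α β : List H} {h h' a b : H}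
    (hc : C.circuit L = ↑(h :: α ++ h' :: β)) (hp : C.Passage a b) (h1 : b ≠ h) (h2 : b ≠ h') :
    F.mate a ∈ h :: α ↔ b ∈ h :: α := by
  have hnd : (h :: α ++ h' :: β).Nodup := by
    simpa [hc] using (C.isOrientedCircuit L).2.1
  have hdis := List.disjoint_of_nodup_append hnd
  constructor
  · intro ha
    have : b ∈ C.circuit L := (C.mate_mem_circuit hp).1 (by
      rw [hc]; exact List.mem_append_left _ ha)
    rw [hc] at this
    rcases List.mem_append.1 this with hb | hb
    · exact hb
    · have hb' : b ∈ β := by simpa [h2] using hb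
      exact absurd (C.mate_mem_of_passage_mem (C.circuit_rotate hc) hp hb') (hdis ha)
  · intro hb
    exact C.mate_mem_of_passage_mem hc hp (by simpa [h1] using hb)

theorem passage_eq_of_vert {w : V} {a b a' b' x y : H} (hset : {h | F.vert h = w} = {a, b, a', b'})
    (hp : C.Passage a b) (hp' : C.Passage a' b') (hx : C.Passage x y) (hw : F.vert x = w) :
    (x = a ∧ y = b) ∨ (x = a' ∧ y = b') := by
  have h0 := C.passage_initial_left hx
  have hm : x = a ∨ x = b ∨ x = a' ∨ x = b' := by simpa using Set.ext_iff.1 hset x |>.1 hw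
  rcases hm with rfl | rfl | rfl | rfl
  · exact .inl ⟨rfl, C.passage_unique_right hx hp⟩
  · exact absurd (C.passage_initial_right hp) h0
  · exact .inr ⟨rfl, C.passage_unique_right hx hp'⟩
  · exact absurd (C.passage_initial_right hp') h0

theorem passages_at {w : V} {b b' : H} (hb : C.Initial b) (hb' : C.Initial b') (hne : b ≠ b')
    (vb : F.vert b = w) (vb' : F.vert b' = w) :
    ∃ a a', [a, b, a', b'].Nodup ∧ {h | F.vert h = w} = {a, b, a', b'} ∧
      C.Passage a b ∧ C.Passage a' b' := by
  obtain ⟨a₁, b₁, a₂, b₂, hnd, hset, i1, j1, i2, j2, p1, p2⟩ := C.local_structure w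
  have hv : ∀ x, F.vert x = w → C.Initial x → x = b₁ ∨ x = b₂ := by
    intro x hx hi
    have hm : x = a₁ ∨ x = b₁ ∨ x = a₂ ∨ x = b₂ := by simpa using Set.ext_iff.1 hset x |>.1 hx
    rcases hm with rfl | rfl | rfl | rfl <;> tauto
  rcases hv b vb hb with rfl | rfl <;> rcases hv b' vb' hb' with rfl | rfl
  · exact absurd rfl hne
  · exact ⟨a₁, a₂, hnd, hset, p1, p2⟩
  · refine ⟨a₂, a₁, ?_, ?_, p2, p1⟩
    · simp at hnd ⊢; grind
    · rw [hset]; ext x; simp; tauto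
  · exact absurd rfl hne

/-- A circulation that is constant along the passages of an Euler system and vanishes on a base
edge set is zero. -/
theorem flow_eq_zero [Fintype H] {E : Set (Sym2 H)} (hE : F.IsBaseEdgeSet E) {K : Type*} [Field K]
    {z : H → K} (hz : z ∈ F.flowSpace E K) (hp : ∀ a b, C.Passage a b → z a + z b = 0) :
    z = 0 := by
  -- Across a passage `z` does not change, so equality holds for consecutive entries, and
  -- transitivity spreads it around the cycle.
  have hconst : ∀ L, ∀ g ∈ C.circuit L, ∀ g' ∈ C.circuit L, z g = z g' := by
    intro L
    have : IsTrans H fun g g' => z g = z g' := ⟨fun _ _ _ h h' => h.trans h'⟩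
    rw [← Cycle.chain_iff_pairwise (r := fun g g' => z g = z g')]
    have step : ∀ {x y}, C.Passage (F.mate x) y → z x = z y := by
      intro x y h
      have := hp _ _ h
      rw [hz.1] at this
      linear_combination -this
    induction hL : C.circuit L using Quotient.inductionOn' with
    | h l =>
      rcases l with _ | ⟨g, l⟩
      · exact Cycle.Chain.nil _
      · rw [Cycle.mk''_eq_coe] at hL ⊢
        rw [Cycle.chain_coe_cons, List.isChain_iff_forall_rel_of_append_cons_cons]
        intro x y l₁ l₂ he
        -- The cycle is checked on the list closed up by its first entry, so the last consecutive
        -- pair is the wrap-around passage and all others lie inside the list.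
        rcases List.eq_nil_or_concat l₂ with rfl | ⟨m, u, rfl⟩
        · have e1 : g :: l = l₁ ++ [x] ∧ g = y := by
            have : (g :: l) ++ [g] = (l₁ ++ [x]) ++ [y] := by simpa using he
            have := List.append_inj' this rfl
            exact ⟨this.1, by simpa using this.2⟩
          rw [e1.1] at hL
          have hg : C.circuit L = ↑(x :: l₁) := C.circuit_rotate hL
          rcases l₁ with _ | ⟨u, l₁⟩
          · simp at e1
            rw [← e1.2, e1.1.1]
          · have : u = y := by rw [← e1.2]; simpa using (List.cons.inj e1.1).1.symm
            subst this
            exact step (C.passage_of_infix (l₁ := []) hg)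
        · have e1 : g :: l = l₁ ++ x :: y :: m := by
            have : (g :: l) ++ [g] = (l₁ ++ x :: y :: m) ++ [u] := by simpa using he
            exact (List.append_inj' this rfl).1
          rw [e1] at hL
          exact step (C.passage_of_infix hL)
  -- The circuit traverses the edge of `E` in its component, where `z` vanishes.
  have hcirc : ∀ L, ∀ g ∈ C.circuit L, z g = 0 := by
    intro L g hg
    obtain ⟨e, ⟨heE, h, hhe, hcomp⟩, -⟩ := hE.2 L
    obtain ⟨x, rfl⟩ := hE.1 heE
    have hx : F.edge h = F.edge x := by
      rcases Sym2.mem_iff.1 hhe with rfl | rfl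
      · rfl
      · exact F.edge_mate x
    rcases (C.euler L h).2 hcomp with h1 | h1
    · rw [hconst L g hg _ h1, hz.2.2 h (hx ▸ heE)]
    · rw [hconst L g hg _ h1, hz.2.2 _ (by rw [F.edge_mate, hx]; exact heE)]
  ext h
  rcases (C.euler _ h).2 rfl with h1 | h1
  · exact hcirc _ _ h1
  · have := hcirc _ _ h1
    rw [hz.1] at this
    simpa using this

namespace FundamentalCircuits

variable {C} (Γ : C.FundamentalCircuits)

/-! ### Fundamental circuits as circulations -/

/-- Local coordinates used throughout: `a`, `b` form the passage at which the fundamental circuit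
begins, and `a'`, `b'` the one at which it ends. -/
theorem exists_local (w : V) : ∃ (a b a' b' : H) (α β : List H), Γ.circ w = b :: α ∧
    C.circuit (F.comp w) = ↑(b :: α ++ b' :: β) ∧ [a, b, a', b'].Nodup ∧
    {h | F.vert h = w} = {a, b, a', b'} ∧ C.Passage a b ∧ C.Passage a' b' := by
  obtain ⟨b, b', α, β, h1, vb, vb', hc⟩ := Γ.isFundamental w
  have hnd : (b :: α ++ b' :: β).Nodup := by
    simpa [hc] using (C.isOrientedCircuit (F.comp w)).2.1
  have hdis := List.disjoint_of_nodup_append hnd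
  have hne : b ≠ b' := fun e => hdis (List.mem_cons_self) (e ▸ List.mem_cons_self)
  have hb : C.Initial b := ⟨_, by rw [hc]; simp⟩
  have hb' : C.Initial b' := ⟨_, by rw [hc]; simp⟩
  obtain ⟨a, a', h2⟩ := C.passages_at hb hb' hne vb vb'
  exact ⟨a, b, a', b', α, β, h1, hc, h2⟩

theorem minusExit_iff {w : V} {b : H} {α : List H} (h : Γ.circ w = b :: α) (x : H) :
    Γ.MinusExit w x ↔ x = b := by
  constructor
  · rintro ⟨γ, h'⟩
    rw [h] at h'
    simp_all
  · rintro rfl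
    exact ⟨_, h⟩

theorem plusExit_iff {w : V} {b b' : H} {α β : List H} (h : Γ.circ w = b :: α)
    (hc : C.circuit (F.comp w) = ↑(b :: α ++ b' :: β)) (x : H) :
    Γ.PlusExit w x ↔ x = b' := by
  constructor
  · rintro ⟨γ, h'⟩
    rw [h] at h'
    rcases List.eq_nil_or_concat (b :: α) with h0 | ⟨m, y, hm⟩
    · simp at h0
    · rw [hm, List.concat_eq_append, List.append_assoc] at h' hc
      exact C.passage_unique_right (C.passage_of_infix h') (C.passage_of_infix hc)
  · rintro rfl
    exact ⟨_, by rw [h, hc]⟩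

theorem mem_circuit {v : V} {h : H} (hh : h ∈ Γ.circ v) : h ∈ C.circuit (F.comp v) := by
  obtain ⟨a, b, a', b', α, β, h1, hc, -⟩ := Γ.exists_local v
  rw [hc]
  exact List.mem_append_left _ (h1 ▸ hh)

theorem mate_mem_iff {v : V} {a b : H} (hp : C.Passage a b) (hv : F.vert b ≠ v) :
    F.mate a ∈ Γ.circ v ↔ b ∈ Γ.circ v := by
  obtain ⟨x, y, x', y', α, β, h1, hc, -, hset, -⟩ := Γ.exists_local v
  rw [h1]
  have key := Set.ext_iff.1 hset
  simp only [Set.mem_ofPred_eq, Set.mem_insert_iff, Set.mem_singleton_iff] at key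
  refine C.mate_mem_iff_of_passage hc hp ?_ ?_
  · rintro rfl; exact hv ((key _).2 (by simp))
  · rintro rfl; exact hv ((key _).2 (by simp))

open Classical in
/-- The circulation given by a fundamental circuit. -/
noncomputable def flow (K : Type*) [Field K] (v : V) : H → K :=
  fun h => (if h ∈ Γ.circ v then 1 else 0) - (if F.mate h ∈ Γ.circ v then 1 else 0)

theorem flow_mate (K : Type*) [Field K] (v : V) (h : H) :
    Γ.flow K v (F.mate h) = -Γ.flow K v h := by
  classical
  rw [flow, flow, neg_sub]
  exact congrArg _ (if_congr (by rw [F.mate_mate]) rfl rfl)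

open Classical in
theorem flow_right (K : Type*) [Field K] (v : V) {b : H} (hb : C.Initial b) :
    Γ.flow K v b = if b ∈ Γ.circ v then 1 else 0 := by
  have : F.mate b ∉ Γ.circ v := fun h =>
    (C.initial_iff b).1 hb ⟨_, Γ.mem_circuit h⟩
  simp [flow, this]

open Classical in
theorem flow_left (K : Type*) [Field K] (v : V) {a : H} (ha : ¬ C.Initial a) :
    Γ.flow K v a = -if F.mate a ∈ Γ.circ v then 1 else 0 := by
  have : a ∉ Γ.circ v := fun h => ha ⟨_, Γ.mem_circuit h⟩
  simp [flow, this]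

theorem flow_passage (K : Type*) [Field K] {v : V} {a b : H} (hp : C.Passage a b)
    (hv : F.vert b ≠ v) : Γ.flow K v a = -Γ.flow K v b := by
  classical
  rw [Γ.flow_left K v (C.passage_initial_left hp), Γ.flow_right K v (C.passage_initial_right hp)]
  simp only [Γ.mate_mem_iff hp hv]

/-- The fundamental circuit leaves `w` through `b`, returns through `a'`, and uses neither `a` nor
`b'`. -/
theorem flow_local (K : Type*) [Field K] {w : V} {a b a' b' : H} {α β : List H}
    (h : Γ.circ w = b :: α) (hc : C.circuit (F.comp w) = ↑(b :: α ++ b' :: β))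
    (hp : C.Passage a b) (hp' : C.Passage a' b') :
    Γ.flow K w a = 0 ∧ Γ.flow K w b = 1 ∧ Γ.flow K w a' = -1 ∧ Γ.flow K w b' = 0 := by
  have hnd : (b :: α ++ b' :: β).Nodup := by
    simpa [hc] using (C.isOrientedCircuit (F.comp w)).2.1
  have hdis := List.disjoint_of_nodup_append hnd
  rw [Γ.flow_left K w (C.passage_initial_left hp), Γ.flow_left K w (C.passage_initial_left hp'),
    Γ.flow_right K w (C.passage_initial_right hp), Γ.flow_right K w (C.passage_initial_right hp'),
    h]
  refine ⟨?_, ?_, ?_, ?_⟩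
  · rw [if_neg fun hm => hdis hm (C.mate_mem_of_passage_left hc hp), neg_zero]
  · simp
  · rw [if_pos (C.mate_mem_of_passage_left (C.circuit_rotate hc) hp')]
  · rw [if_neg fun hm => hdis hm (by simp)]

/-- At its own vertex the circuit leaves once and returns once; at any other vertex each passage is
balanced by itself. -/
theorem flow_mem [Fintype H] {E : Set (Sym2 H)} (hΓ : Γ.IsBased E) (K : Type*) [Field K]
    (v : V) : Γ.flow K v ∈ F.flowSpace E K := by
  classical
  refine ⟨Γ.flow_mate K v, fun w => ?_, fun h hh => ?_⟩
  · obtain ⟨a, b, a', b', α, β, h1, hc, hnd, hset, hp, hp'⟩ := Γ.exists_local w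
    rw [outflow_apply, sum_vertex_eq hnd hset]
    by_cases hvw : w = v
    · subst hvw
      obtain ⟨e1, e2, e3, e4⟩ := Γ.flow_local K h1 hc hp hp'
      rw [e1, e2, e3, e4]; ring
    · have vb : F.vert b = w := (Set.ext_iff.1 hset b).2 (by simp)
      have vb' : F.vert b' = w := (Set.ext_iff.1 hset b').2 (by simp)
      rw [Γ.flow_passage K hp (vb ▸ hvw), Γ.flow_passage K hp' (vb' ▸ hvw)]
      ring
  · have h1 : h ∉ Γ.circ v := fun hm => hΓ v h hm hh
    have h2 : F.mate h ∉ Γ.circ v := fun hm => hΓ v _ hm (by rwa [F.edge_mate])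
    simp [flow, h1, h2]

theorem includesMinus_iff {v w : V} {b : H} {α : List H} (h : Γ.circ w = b :: α) :
    Γ.IncludesMinus v w ↔ b ∈ Γ.circ v := by
  simp [IncludesMinus, Γ.minusExit_iff h]

theorem includesPlus_iff {v w : V} {b b' : H} {α β : List H} (h : Γ.circ w = b :: α)
    (hc : C.circuit (F.comp w) = ↑(b :: α ++ b' :: β)) :
    Γ.IncludesPlus v w ↔ b' ∈ Γ.circ v := by
  simp [IncludesPlus, Γ.plusExit_iff h hc]

/-- The columns of the integer matrix list the flows of the fundamental circuits through a
transition. -/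
theorem exists_IAS_eq_flow (K : Type*) [Field K] (x : GroundW V) :
    ∃ p q, s(p, q) ∈ (C.transition x).pairs ∧
      ∀ v, ((Γ.IAS v x : ℤ) : K) = Γ.flow K v p + Γ.flow K v q := by
  classical
  obtain ⟨k, w⟩ := x
  obtain ⟨a, b, a', b', α, β, h1, hc, hnd, hset, hp, hp'⟩ := Γ.exists_local w
  have ia := C.passage_initial_left hp
  have ia' := C.passage_initial_left hp'
  have ib := C.passage_initial_right hp
  have ib' := C.passage_initial_right hp'
  have vb : F.vert b = w := (Set.ext_iff.1 hset b).2 (by simp)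
  obtain ⟨l1, l2, l3⟩ := C.labelPairs_eq hnd hset ia ib ia' ib' hp hp'
  obtain ⟨e1, e2, e3, e4⟩ := Γ.flow_local K h1 hc hp hp'
  have hm : ∀ v, Γ.IncludesMinus v w ↔ b ∈ Γ.circ v := fun v => Γ.includesMinus_iff h1
  have hpl : ∀ v, Γ.IncludesPlus v w ↔ b' ∈ Γ.circ v := fun v => Γ.includesPlus_iff h1 hc
  cases k
  -- A passage of `C` away from `v` is balanced, so only `v = w` contributes: the identity block.
  · refine ⟨a, b, l1.symm.subset (by simp), fun v => ?_⟩
    by_cases hvw : v = w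
    · subst hvw
      simp [IAS, e1, e2]
    · rw [Γ.flow_passage K hp (vb ▸ Ne.symm hvw)]
      simp [IAS, hvw]
  -- Since the flow at `a` is minus the flow at `b` for `v ≠ w`, the sum counts the later passage
  -- minus the earlier one.
  · refine ⟨a, b', l2.symm.subset (by simp), fun v => ?_⟩
    by_cases hvw : v = w
    · subst hvw
      simp [IAS, matA, e1, e4]
    · rw [Γ.flow_passage K hp (vb ▸ Ne.symm hvw), Γ.flow_right K v ib, Γ.flow_right K v ib']
      by_cases c1 : b ∈ Γ.circ v <;> by_cases c2 : b' ∈ Γ.circ v <;>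
        simp [IAS, matA, hvw, hm, hpl, c1, c2]
  -- Both half-edges are exits, so the sum counts the included passages.
  · refine ⟨b, b', l3.symm.subset (by simp), fun v => ?_⟩
    by_cases hvw : v = w
    · subst hvw
      simp [IAS, matB, e2, e4]
    · rw [Γ.flow_right K v ib, Γ.flow_right K v ib']
      by_cases c1 : b ∈ Γ.circ v <;> by_cases c2 : b' ∈ Γ.circ v <;>
        simp [IAS, matB, hvw, hm, hpl, c1, c2]
      norm_num

/-! ### Representing the matroid by transition functionals. -/

section Independence

variable [Fintype H] {E : Set (Sym2 H)} (K : Type*) [Field K]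

/-- The values of a functional at the fundamental circuits. -/
noncomputable def evalFlows (hΓ : Γ.IsBased E) : Module.Dual K (F.flowSpace E K) →ₗ[K] (V → K) :=
  LinearMap.pi fun v => LinearMap.applyₗ (⟨Γ.flow K v, Γ.flow_mem hΓ K v⟩ : F.flowSpace E K)

theorem evalFlows_apply (hΓ : Γ.IsBased E) (f : Module.Dual K (F.flowSpace E K)) (v : V) :
    Γ.evalFlows K hΓ f v = f ⟨Γ.flow K v, Γ.flow_mem hΓ K v⟩ := rfl

/-- The fundamental circuits span the space of circulations. -/
theorem exists_eq_sum_flow [Fintype V] (hΓ : Γ.IsBased E) (hE : F.IsBaseEdgeSet E)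
    {z : H → K} (hz : z ∈ F.flowSpace E K) : ∃ c : V → K, z = ∑ v, c v • Γ.flow K v := by
  classical
  choose a b a' b' α β h1 hc hnd hset hp hp' using Γ.exists_local
  -- The coefficients are the flows of `z` through the `φ` transitions. The `φ` block being the
  -- identity, the difference has no flow through any of them, and `flow_eq_zero` applies.
  refine ⟨fun v => z (a v) + z (b v), sub_eq_zero.1 ?_⟩
  set y := z - ∑ v, (z (a v) + z (b v)) • Γ.flow K v with hy
  have hym : y ∈ F.flowSpace E K :=
    Submodule.sub_mem _ hz (Submodule.sum_mem _ fun v _ =>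
      Submodule.smul_mem _ _ (Γ.flow_mem hΓ K v))
  have h0 : ∀ w, y (a w) + y (b w) = 0 := by
    intro w
    have key : ∀ v, Γ.flow K v (a w) + Γ.flow K v (b w) = if v = w then 1 else 0 := by
      intro v
      split_ifs with hvw
      · subst hvw
        obtain ⟨e1, e2, -⟩ := Γ.flow_local K (h1 v) (hc v) (hp v) (hp' v)
        rw [e1, e2, zero_add]
      · have vb : F.vert (b w) = w := (Set.ext_iff.1 (hset w) (b w)).2 (by simp)
        rw [Γ.flow_passage K (hp w) (vb.symm ▸ Ne.symm hvw), neg_add_cancel]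
    have : ∑ v, (z (a v) + z (b v)) * (Γ.flow K v (a w) + Γ.flow K v (b w)) =
        z (a w) + z (b w) := by
      simp [key]
    simp only [mul_add, Finset.sum_add_distrib] at this
    simp only [hy, Pi.sub_apply, Finset.sum_apply, Pi.smul_apply, smul_eq_mul]
    linear_combination -this
  refine C.flow_eq_zero hE hym fun x u hx => ?_
  rcases C.passage_eq_of_vert (hset (F.vert x)) (hp _) (hp' _) hx rfl with ⟨e, rfl⟩ | ⟨e, rfl⟩
  · exact (congrArg (fun x' => y x' + _) e).trans (h0 _)
  · refine (congrArg (fun x' => y x' + _) e).trans ?_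
    have := flow_conservation (hnd (F.vert x)) (hset (F.vert x)) hym
    linear_combination this - h0 (F.vert x)

theorem evalFlows_injective [Finite V] (hΓ : Γ.IsBased E) (hE : F.IsBaseEdgeSet E) :
    Function.Injective (Γ.evalFlows K hΓ) := by
  have := Fintype.ofFinite V
  rw [← LinearMap.ker_eq_bot, LinearMap.ker_eq_bot']
  intro f hf
  ext z
  obtain ⟨c, hc⟩ := Γ.exists_eq_sum_flow K hΓ hE z.2
  have : z = ∑ v, c v • (⟨Γ.flow K v, Γ.flow_mem hΓ K v⟩ : F.flowSpace E K) := by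
    ext1
    simpa using hc
  rw [this, map_sum]
  refine Finset.sum_eq_zero fun v _ => ?_
  rw [map_smul, ← Γ.evalFlows_apply K hΓ, hf, Pi.zero_apply, smul_zero]

/-- Each column is a unit multiple of the image of a functional under the injective map `evalFlows`;
neither the units nor the map affects independence. -/
theorem matroid_indep_iff [Finite V] (hΓ : Γ.IsBased E) (hE : F.IsBaseEdgeSet E) (J : Set (GroundW V)) :
    (Γ.matroid K).Indep J ↔
      LinearIndepOn K (fun x => (C.transition x).functional E K) J := by
  rw [matroid, Matrix.colMatroid_indep_iff,
    ← LinearMap.linearIndepOn_iff_of_injOn (Γ.evalFlows K hΓ)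
      (Γ.evalFlows_injective K hΓ hE).injOn]
  have h : ∀ x, ∃ ε : Kˣ, (Γ.IAS.map (Int.cast : ℤ → K)).col x =
      ε • Γ.evalFlows K hΓ ((C.transition x).functional E K) := by
    intro x
    obtain ⟨p, q, hpq, h⟩ := Γ.exists_IAS_eq_flow K x
    obtain ⟨ε, hε⟩ := (C.transition x).exists_flow_eq_mul (E := E) (K := K) hpq
    refine ⟨ε, funext fun v => ?_⟩
    rw [Matrix.col_apply, Matrix.map_apply, h, hε _ (Γ.flow_mem hΓ K v)]
    rfl
  choose ε hε using h
  refine Iff.trans ?_ (LinearIndependent.units_smul_iff _ fun x : J => ε x)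
  rw [LinearIndepOn]
  simp only [hε]
  rfl

/-- The criterion on the right involves neither the Euler system nor its fundamental circuits; this
is the source of invariance. -/
theorem transitionMatroid_indep_iff [Finite V] (hΓ : Γ.IsBased E) (hE : F.IsBaseEdgeSet E) (I : Set F.Transition) :
    (Γ.transitionMatroid K).Indep I ↔ LinearIndepOn K (fun t => t.functional E K) I := by
  rw [transitionMatroid, Matroid.mapEquiv_indep_iff, Γ.matroid_indep_iff K hΓ hE]
  have e : I = C.transitionEquiv '' (C.transitionEquiv.symm '' I) := by
    simp [Set.image_image]
  conv_rhs => rw [e, ← linearIndepOn_equiv]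
  rfl

end Independence

end FundamentalCircuits
end OrientedEulerSystem
end FourRegularGraph

/-! ### Rotations of lists and subtransversals. -/

theorem List.Nodup.eq_of_isRotated_cons {α : Type*} {a : α} {l l' : List α} (hn : (a :: l).Nodup)
    (h : (a :: l) ~r (a :: l')) : l = l' := by
  obtain ⟨n, hn'⟩ := h
  rw [List.rotate_eq_drop_append_take_mod] at hn'
  have hs := List.take_append_drop (n % (a :: l).length) (a :: l)
  set x := List.take (n % (a :: l).length) (a :: l)
  set y := List.drop (n % (a :: l).length) (a :: l)
  rcases x with _ | ⟨b, x⟩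
  · simp only [List.append_nil] at hn'
    simp only [List.nil_append] at hs
    exact (List.cons.inj (hs.symm.trans hn')).2
  · rcases y with _ | ⟨c, y⟩
    · simp only [List.append_nil] at hs
      simp only [List.nil_append] at hn'
      exact (List.cons.inj (hs.symm.trans hn')).2
    · obtain rfl : b = a := (List.cons.inj hs).1
      obtain rfl : c = b := (List.cons.inj hn').1
      rw [← hs] at hn
      simp at hn

theorem SimpleGraph.encard_isotropicThreeMatroid_omega {V : Type*} [Finite V] (G : SimpleGraph V) :
    G.isotropicThreeMatroid.Ω.encard = (Set.univ : Set V).encard := by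
  have : G.isotropicThreeMatroid.Ω = (fun v : V =>
      ({(.phi, v), (.chi, v), (.psi, v)} : Set (GroundW V))) '' Set.univ := by
    ext ω
    simp [SimpleGraph.isotropicThreeMatroid, eq_comm]
  rw [this, Function.Injective.encard_image]
  intro v w h
  have := (Set.ext_iff.1 h (.phi, v)).1 (by simp)
  simpa using this

theorem SimpleGraph.injOn_snd_of_isSubtransversal {V : Type*} [Finite V] {G : SimpleGraph V} {S : Set (GroundW V)}
    (hS : IsSubtransversal G.isotropicThreeMatroid.Ω S) : Set.InjOn Prod.snd S := by
  obtain ⟨T, hT, hST⟩ := hS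
  rintro ⟨k, v⟩ hx ⟨l, w⟩ hy (rfl : v = w)
  obtain ⟨z, -, hz⟩ := hT.2 {(.phi, v), (.chi, v), (.psi, v)} ⟨v, rfl⟩
  have mem : ∀ k : Kind, (k, v) ∈ ({(.phi, v), (.chi, v), (.psi, v)} : Set (GroundW V)) := by
    intro k; cases k <;> simp
  exact (hz _ ⟨hST hx, mem k⟩).trans (hz _ ⟨hST hy, mem l⟩).symm

namespace FourRegularGraph
namespace OrientedEulerSystem

variable {V H : Type*} {F : FourRegularGraph V H} {C : F.OrientedEulerSystem}

namespace FundamentalCircuits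

variable (Γ : C.FundamentalCircuits)

/-! ### Interlacement and the binary matrix -/

/-- The cyclic list has no repeated entry, so its two exits `c` and `c'` determine the stretch
between them. -/
theorem circ_eq {v : V} {c c' : H} {γ δ γ' δ' : List H} (h : Γ.circ v = c :: γ)
    (hc : C.circuit (F.comp v) = ↑(c :: γ ++ c' :: δ))
    (hc' : C.circuit (F.comp v) = ↑(c :: γ' ++ c' :: δ')) : Γ.circ v = c :: γ' := by
  have hnd : (c :: γ ++ c' :: δ).Nodup := by
    simpa [hc] using (C.isOrientedCircuit (F.comp v)).2.1
  have hrot : (c :: (γ ++ c' :: δ)) ~r (c :: (γ' ++ c' :: δ')) := by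
    rw [← Cycle.coe_eq_coe]
    exact hc.symm.trans hc'
  have he : γ ++ c' :: δ = γ' ++ c' :: δ' := hnd.eq_of_isRotated_cons hrot
  rw [List.append_cons_inj_of_notMem] at he
  · rw [h, he.1]
  · exact fun hm => List.disjoint_of_nodup_append hnd.of_cons hm List.mem_cons_self
  · exact (List.nodup_cons.1 (List.nodup_append.1 hnd.of_cons).2.1).1

theorem interlaced_of_mem {v w : V} {b b' : H} (hb' : C.Initial b') (vb : F.vert b = w)
    (vb' : F.vert b' = w) (hvw : v ≠ w) (h : b ∈ Γ.circ v)
    (h' : b' ∉ Γ.circ v) : C.Interlaced v w := by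
  obtain ⟨x, c, x', c', γ, δ, h1, hc, -, hset, -⟩ := Γ.exists_local v
  have key := Set.ext_iff.1 hset
  simp only [Set.mem_ofPred_eq, Set.mem_insert_iff, Set.mem_singleton_iff] at key
  have vc : F.vert c = v := (key c).2 (by simp)
  have vc' : F.vert c' = v := (key c').2 (by simp)
  have hbK := Γ.mem_circuit h
  have hcomp : F.comp (F.vert b') = F.comp v := by
    rw [vb', ← vb]; exact C.comp_eq_of_mem hbK
  have hbK' : b' ∈ C.circuit (F.comp v) := by
    rcases (C.euler _ b').2 hcomp with h2 | h2
    · exact h2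
    · exact absurd ⟨_, h2⟩ ((C.initial_iff b').1 hb')
  rw [h1] at h h'
  rw [hc] at hbK'
  have hbγ : b ∈ γ := by
    rcases List.mem_cons.1 h with rfl | hm
    · exact absurd (vc.symm.trans vb) hvw
    · exact hm
  have hbδ : b' ∈ δ := by
    rcases List.mem_append.1 hbK' with hm | hm
    · exact absurd hm h'
    · rcases List.mem_cons.1 hm with rfl | hm
      · exact absurd (vc'.symm.trans vb') hvw
      · exact hm
  obtain ⟨γ₁, γ₂, rfl⟩ := List.append_of_mem hbγ
  obtain ⟨δ₁, δ₂, rfl⟩ := List.append_of_mem hbδ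
  refine ⟨hvw, F.comp v, γ₁.map F.vert, γ₂.map F.vert, δ₁.map F.vert, δ₂.map F.vert, ?_⟩
  rw [hc, Cycle.map_coe]
  simp [vb, vb', vc, vc']

/-- The two visits to `v` cut its circuit into two stretches, one being the fundamental circuit;
interlacement means that they separate the two visits to `w`. -/
theorem interlaced_iff {v w : V} {a b a' b' : H} (hset : {h | F.vert h = w} = {a, b, a', b'})
    (hp : C.Passage a b) (hp' : C.Passage a' b') (hvw : v ≠ w) :
    C.Interlaced v w ↔ ¬(b ∈ Γ.circ v ↔ b' ∈ Γ.circ v) := by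
  have key := Set.ext_iff.1 hset
  simp only [Set.mem_ofPred_eq, Set.mem_insert_iff, Set.mem_singleton_iff] at key
  have vb : F.vert b = w := (key b).2 (by simp)
  have vb' : F.vert b' = w := (key b').2 (by simp)
  have ib := C.passage_initial_right hp
  have ib' := C.passage_initial_right hp'
  constructor
  · rintro ⟨-, L, l₁, l₂, l₃, l₄, hL⟩
    obtain ⟨l, hl⟩ : ∃ l : List H, C.circuit L = ↑l := ⟨_, (Quotient.out_eq _).symm⟩
    rw [hl, Cycle.map_coe, Cycle.coe_eq_coe] at hL
    obtain ⟨n, hn⟩ := hL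
    rw [← List.map_rotate] at hn
    have hl' : C.circuit L = ↑(l.rotate n) := by
      rw [hl, Cycle.coe_eq_coe]
      exact ⟨n, rfl⟩
    -- The pattern of vertices is lifted to half-edges: `p`, `r` are exits from `v`, and `q`, `s`
    -- exits from `w`.
    simp only [List.map_eq_append_iff, List.map_eq_cons_iff] at hn
    obtain ⟨_, _, e, ⟨_, _, rfl, ⟨_, _, rfl, ⟨p, P₁, rfl, vp, -⟩, ⟨q, P₂, rfl, vq, -⟩⟩,
      ⟨r, P₃, rfl, vr, -⟩⟩, ⟨s, P₄, rfl, vs, -⟩⟩ := hn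
    rw [e] at hl'
    have hnd : (p :: P₁ ++ q :: P₂ ++ r :: P₃ ++ s :: P₄).Nodup := by
      simpa [hl'] using (C.isOrientedCircuit L).2.1
    have hmem : ∀ x ∈ (p :: P₁ ++ q :: P₂ ++ r :: P₃ ++ s :: P₄), C.Initial x :=
      fun x hx => ⟨L, by rw [hl']; exact hx⟩
    obtain rfl : F.comp v = L := by
      rw [← vp]
      exact C.comp_eq_of_mem (by rw [hl']; simp)
    obtain ⟨x, c, x', c', γ, δ, h1, hc, -, hset', hpc, hpc'⟩ := Γ.exists_local v
    have exit : ∀ {u : V} {a b a' b' : H}, {h | F.vert h = u} = {a, b, a', b'} →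
        C.Passage a b → C.Passage a' b' → ∀ y, F.vert y = u → C.Initial y → y = b ∨ y = b' := by
      intro u a b a' b' hs hp hp' y hy hi
      obtain ⟨z, hz⟩ := C.passage_exists_left hi
      have := C.passage_eq_of_vert hs hp hp' hz ((C.passage_vert hz).trans hy)
      tauto
    have ep := exit hset' hpc hpc' p vp (hmem p (by simp))
    have er := exit hset' hpc hpc' r vr (hmem r (by simp))
    have eq := exit hset hp hp' q vq (hmem q (by simp))
    have es := exit hset hp hp' s vs (hmem s (by simp))
    have hpr : p ≠ r := by rintro rfl; simp at hnd
    have hdis : (p :: P₁ ++ q :: P₂).Disjoint (r :: P₃ ++ s :: P₄) := by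
      apply List.disjoint_of_nodup_append
      simpa using hnd
    have hqs : q ≠ s := by
      rintro rfl
      exact hdis (a := q) (by simp) (by simp)
    have main : ¬(q ∈ Γ.circ v ↔ s ∈ Γ.circ v) := by
      -- The fundamental circuit at `v` may begin at either visit, so it is the stretch containing
      -- `q` or the one containing `s`.
      rcases ep with rfl | rfl
      · obtain rfl : r = c' := er.resolve_left (Ne.symm hpr)
        have := Γ.circ_eq (γ' := P₁ ++ q :: P₂) (δ' := P₃ ++ s :: P₄) h1 hc (by
          rw [hl']; simp)
        rw [this]
        have hs : s ∉ p :: (P₁ ++ q :: P₂) := fun hm => hdis hm (by simp)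
        simp only [hs, iff_false, not_not]
        simp
      · obtain rfl : r = c := er.resolve_right (Ne.symm hpr)
        have := Γ.circ_eq (γ' := P₃ ++ s :: P₄) (δ' := P₁ ++ q :: P₂) h1 hc (by
          have := C.circuit_rotate (l₁ := p :: P₁ ++ q :: P₂) (l₂ := r :: P₃ ++ s :: P₄)
            (by rw [hl']; simp)
          rw [this]; simp)
        rw [this]
        have hs : q ∉ r :: (P₃ ++ s :: P₄) := fun hm => hdis (by simp) hm
        simp only [hs, false_iff, not_not]
        simp
    rcases eq with rfl | rfl
    · obtain rfl : s = b' := es.resolve_left (Ne.symm hqs)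
      exact main
    · obtain rfl : s = b := es.resolve_right (Ne.symm hqs)
      exact fun h => main h.symm
  · intro h
    by_cases hb : b ∈ Γ.circ v
    · exact Γ.interlaced_of_mem ib' vb vb' hvw hb (by tauto)
    · exact Γ.interlaced_of_mem ib vb' vb hvw (by tauto) hb

/-- Modulo 2 the signs disappear and 2 becomes 0, so off the diagonal both `A` and `B` record
whether exactly one passage of `w` is included, which is interlacement. -/
theorem IAS_map_zmod_two :
    Γ.IAS.map (Int.cast : ℤ → ZMod 2) = C.interlacementGraph.IAS := by
  classical
  ext v ⟨k, w⟩
  obtain ⟨a, b, a', b', α, β, h1, hc, -, hset, hp, hp'⟩ := Γ.exists_local w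
  have hm : Γ.IncludesMinus v w ↔ b ∈ Γ.circ v := Γ.includesMinus_iff h1
  have hpl : Γ.IncludesPlus v w ↔ b' ∈ Γ.circ v := Γ.includesPlus_iff h1 hc
  by_cases hvw : v = w
  · subst hvw
    cases k <;> simp [IAS, matA, matB, SimpleGraph.IAS]
  · have hadj : C.interlacementGraph.Adj v w ↔ ¬(b ∈ Γ.circ v ↔ b' ∈ Γ.circ v) :=
      Γ.interlaced_iff hset hp hp' hvw
    have two : (2 : ZMod 2) = 0 := by decide
    by_cases c1 : b ∈ Γ.circ v <;> by_cases c2 : b' ∈ Γ.circ v <;> cases k <;>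
      simp [IAS, matA, matB, SimpleGraph.IAS, SimpleGraph.adjMatrix_apply, hadj,
        hm, hpl, hvw, c1, c2, two]

/-! ### The strict sheltering property -/

theorem eRank_matroid [Finite V] (K : Type*) [Field K] :
    (Γ.matroid K).eRank = (Set.univ : Set V).encard := by
  classical
  have := Fintype.ofFinite V
  apply le_antisymm
  · obtain ⟨B, hB⟩ := (Γ.matroid K).exists_isBase
    rw [← hB.encard_eq_eRank]
    have h : LinearIndepOn K _ B := hB.indep
    refine h.encard_le_toENat_rank.trans ?_
    rw [rank_fun']
    simp
  · have h : (Γ.matroid K).Indep (Set.range fun v : V => (Kind.phi, v)) := by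
      rw [matroid, Matrix.colMatroid_indep_iff]
      rw [← Set.image_univ]
      apply LinearIndepOn.image_of_comp
      rw [linearIndepOn_univ_iff]
      convert (Pi.basisFun K V).linearIndependent
      ext v w
      simp [IAS, Matrix.one_apply, Pi.single_apply]
    refine le_trans ?_ h.encard_le_eRank
    rw [← Set.image_univ, Function.Injective.encard_image]
    intro a b h
    simpa using h

theorem transitionMatroid_ground [Finite V] (K : Type*) [Field K] :
    (Γ.transitionMatroid K).E = Set.univ := by
  rw [transitionMatroid, Matroid.mapEquiv_ground_eq]
  exact (congrArg _ rfl).trans (Set.image_univ_of_surjective C.transitionEquiv.surjective)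

/-- Having at most one element per vertex lets the labeling criterion apply to the corresponding
transitions. -/
theorem indep_of_field [Finite V] {E : Set (Sym2 H)} (hE : F.IsBaseEdgeSet E)
    (hΓ : Γ.IsBased E) (K L : Type*) [Field K] [Field L] {J : Set (GroundW V)}
    (hJ : Set.InjOn Prod.snd J) (h : (Γ.matroid K).Indep J) : (Γ.matroid L).Indep J := by
  have := F.finite_halfEdges
  have := Fintype.ofFinite H
  rw [Γ.matroid_indep_iff _ hΓ hE] at h ⊢
  have hinj : Set.InjOn Transition.vertex (C.transition '' J) := by
    rintro _ ⟨x, hx, rfl⟩ _ ⟨y, hy, rfl⟩ hxy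
    rw [hJ hx hy hxy]
  exact (linearIndepOn_functional_of_field L hinj
    (LinearIndepOn.image_of_comp C.transition (fun t => t.functional E K) h)).comp_of_image
      C.transition_bijective.1.injOn

end FundamentalCircuits
end OrientedEulerSystem
end FourRegularGraph

theorem mainTheorem7 {V H : Type*} [Finite V] (F : FourRegularGraph V H)
    (E : Set (Sym2 H)) (hE : F.IsBaseEdgeSet E) (K : Type*) [Field K]
    (C : F.OrientedEulerSystem) (Γ : C.FundamentalCircuits) (hΓ : Γ.IsBased E) :
    C.interlacementGraph.isotropicThreeMatroid.StrictlyShelteredBy (Γ.matroid K) ∧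
    ∀ (C' : F.OrientedEulerSystem) (Γ' : C'.FundamentalCircuits), Γ'.IsBased E →
      Γ.transitionMatroid K = Γ'.transitionMatroid K := by
  refine ⟨⟨⟨rfl, fun S => ?_⟩, ?_⟩, fun C' Γ' hΓ' => ?_⟩
  · have hinj := SimpleGraph.injOn_snd_of_isSubtransversal S.2
    change (Γ.matroid K).eRk S.1 = C.interlacementGraph.IAS.colMatroid.eRk S.1
    have e : C.interlacementGraph.IAS.colMatroid = Γ.matroid (ZMod 2) := by
      rw [← Γ.IAS_map_zmod_two]; rfl
    -- The rank of `S` is that of the restriction to `S`, so it suffices to compare independent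
    -- subsets of `S`, which are again subtransversals.
    rw [e, ← Matroid.eRank_restrict, ← Matroid.eRank_restrict (Γ.matroid (ZMod 2))]
    congr 1
    refine Matroid.ext_indep rfl fun I hI => ?_
    have hI' : Set.InjOn Prod.snd I := hinj.mono hI
    rw [Matroid.restrict_indep_iff, Matroid.restrict_indep_iff]
    exact and_congr_left fun _ =>
      ⟨Γ.indep_of_field hE hΓ K (ZMod 2) hI', Γ.indep_of_field hE hΓ (ZMod 2) K hI'⟩
  · rw [Γ.eRank_matroid,
      SimpleGraph.encard_isotropicThreeMatroid_omega]
  · have := F.finite_halfEdges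
    have := Fintype.ofFinite H
    refine Matroid.ext_indep (Γ.transitionMatroid_ground K |>.trans (Γ'.transitionMatroid_ground K).symm)
      fun I _ => ?_
    rw [Γ.transitionMatroid_indep_iff K hΓ hE, Γ'.transitionMatroid_indep_iff K hΓ' hE]
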